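/- Let $q$ be a prime power, let $1\le \ell<m$ be integers, let $V$ be an $m$-dimensional vector space over $\mathbb F_q$, and let $A_1\subset\cdots\subset A_\ell$ be a strictly increasing chain of nonzero subspaces of $V$. Put $\alpha_i=\dim A_i$, $\alpha=(\alpha_1,\dots,\alpha_\ell)$ and $\delta(\alpha)=\sum_{i=1}^{\ell}(\alpha_i-i)$. Let $$\Omega_\alpha(\ell,m)=\{L\subseteq V:\ \dim L=\ell,\ \dim(L\cap A_i)\ge i \text{ for } i=1,\dots,\ell\}=\{L_1,\dots,L_n\},$$ and for every $j$ let $P_j=v_1\wedge\cdots\wedge v_\ell\in\bigwedge^\ell V$ for some basis $v_1,\dots,v_\ell$ of $L_j$. Fix a linear isomorphism $\bigwedge^m V\cong\mathbb F_q$ and use it as an identification. For $f\in\bigwedge^{m-\ell}V$ put $c_f=(f\wedge P_1,\dots,f\wedge P_n)\in\mathbb F_q^{\,n}$, and let the Schubert code $C_\alpha(\ell,m)\subseteq\mathbb F_q^{\,n}$ be the set of all $c_f$, $f\in\bigwedge^{m-\ell}V$. For a linear code $C$ let $d(C)$ be the minimum of the Hamming weights $\operatorname{wt}(c)$ over nonzero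 $c\in C$; a minimum weight codeword of $C$ is a nonzero $c\in C$ with $\operatorname{wt}(c)=d(C)$. Then $$d(C_\alpha(\ell,m))=q^{\delta(\alpha)}.$$ Moreover, suppose that $\ell>1$ and that $f\in\bigwedge^{m-\ell}V$ is such that $c_f$ is a minimum weight codeword of $C_\alpha(\ell,m)$. Let $\alpha'=(\alpha_1,\dots,\alpha_{\ell-1})$, let $C_{\alpha'}(\ell-1,m)$ be the Schubert code of the truncated chain $A_1\subset\cdots\subset A_{\ell-1}$, and for $x\in V$ let $c_{f\wedge x}\in C_{\alpha'}(\ell-1,m)$ be the codeword of $f\wedge x\in\bigwedge^{m-\ell+1}V$. Let $$E=\{x\in A_\ell:\ c_{f\wedge x}=0\},\qquad F=A_\ell\setminus E,\qquad t=\operatorname{codim}_{A_\ell}E,\qquad t'=\operatorname{codim}_{A_{\ell-1}}(E\cap A_{\ell-1}).$$ Then $c_{f\wedge x}$ is a minimum weight codeword of $C_{\alpha'}(\ell-1,m)$ for every $x\in F$, and one of the following holds: (i) $t=1$ and $t'=0$; or (ii) $t'=t\ge 2$, $\alpha_\ell-\alpha_{\ell-1}=1$, and $$\operatorname{wt}(c_f)=\frac1{q^{\ell-1}(q-1)}\sum_{x\in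 F\setminus A_{\ell-1}}\operatorname{wt}(c_{f\wedge x})+\frac1{q^{\ell-1}(q^t-1)}\sum_{x\in F\cap A_{\ell-1}}\operatorname{wt}(c_{f\wedge x}).$$ -/

import Mathlib

open Module

namespace SchubertCodes

section Coding

variable {ι K : Type*} [Fintype ι] [Field K] [DecidableEq K]

/-- The minimum distance `d(C)` of a linear code `C ⊆ K^ι`: the least Hamming weight of a nonzero
codeword. (For the zero code the infimum is over the empty set and has the junk value `0`; a
nonzero value of `minDist C` is always attained by a nonzero codeword.) -/
noncomputable def minDist (C : Submodule K (ι → K)) : ℕ :=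
  sInf {w : ℕ | ∃ c ∈ C, c ≠ 0 ∧ hammingNorm c = w}

/-- `c` is a minimum weight codeword of the linear code `C`. -/
def IsMinWeightCodeword (C : Submodule K (ι → K)) (c : ι → K) : Prop :=
  c ∈ C ∧ c ≠ 0 ∧ hammingNorm c = minDist C

end Coding

section Exterior

variable {K V : Type*} [Field K] [AddCommGroup V] [Module K V]

/-- The wedge product `⋀^a V × ⋀^b V → ⋀^c V` for `a + b = c`, i.e. the product of the exterior
algebra. -/
noncomputable def wedge {a b c : ℕ} (h : a + b = c) :
    ⋀[K]^a V →ₗ[K] ⋀[K]^b V →ₗ[K] ⋀[K]^c V :=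
  LinearMap.mk₂ K
    (fun f g => ⟨(f : ExteriorAlgebra K V) * (g : ExteriorAlgebra K V),
      h ▸ SetLike.mul_mem_graded (A := fun i : ℕ => ⋀[K]^i V) f.2 g.2⟩)
    (fun _ _ _ => Subtype.ext (add_mul _ _ _))
    (fun _ _ _ => Subtype.ext (smul_mul_assoc _ _ _))
    (fun _ _ _ => Subtype.ext (mul_add _ _ _))
    (fun _ _ _ => Subtype.ext (mul_smul_comm _ _ _))

/-- The map `x ↦ f ∧ x` from `V = ⋀^1 V` to `⋀^c V`, for `f ∈ ⋀^a V` and `a + 1 = c`. -/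
noncomputable def wedgeVec {a c : ℕ} (h : a + 1 = c) (f : ⋀[K]^a V) : V →ₗ[K] ⋀[K]^c V :=
  wedge h f ∘ₗ (exteriorPower.oneEquiv K V).symm.toLinearMap

/-- The codimension of `U` in `W`, for subspaces `U ≤ W` of `V`. -/
noncomputable def codimIn (W U : Submodule K V) : ℕ :=
  finrank K (W ⧸ U.submoduleOf W)

end Exterior

section Schubert

variable {K V : Type*} [Field K] [AddCommGroup V] [Module K V]

/-- `A_1 ⊂ ⋯ ⊂ A_ℓ` is a partial flag of nonzero subspaces of `V` (strict inclusions). Only the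
values of `A` at the indices `1, …, ℓ` matter. -/
structure IsPartialFlag (A : ℕ → Submodule K V) (ℓ : ℕ) : Prop where
  strictMonoOn : StrictMonoOn A (Set.Icc 1 ℓ)
  ne_bot : ∀ i ∈ Set.Icc 1 ℓ, A i ≠ ⊥

/-- The Schubert variety of the partial flag `A_1 ⊂ ⋯ ⊂ A_ℓ`: the `ℓ`-dimensional subspaces `L`
of `V` such that `dim (L ∩ A_i) ≥ i` for `1 ≤ i ≤ ℓ`. For `k ≤ ℓ`, `SchubertVariety A k` is the
Schubert variety of the truncated flag `A_1 ⊂ ⋯ ⊂ A_k`. -/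
def SchubertVariety (A : ℕ → Submodule K V) (ℓ : ℕ) : Type _ :=
  {L : Submodule K V // finrank K L = ℓ ∧ ∀ i ∈ Set.Icc 1 ℓ, i ≤ finrank K ↥(L ⊓ A i)}

instance [Finite K] [FiniteDimensional K V] (A : ℕ → Submodule K V) (ℓ : ℕ) :
    Finite (SchubertVariety A ℓ) :=
  haveI : Finite V := Module.finite_of_finite K
  inferInstanceAs (Finite {_L : Submodule K V // _})

noncomputable instance [Finite K] [FiniteDimensional K V] (A : ℕ → Submodule K V) (ℓ : ℕ) :
    Fintype (SchubertVariety A ℓ) :=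
  Fintype.ofFinite _

/-- `P` chooses, for every point `L` of the Schubert variety, a representative in `⋀^ℓ V` of its
Plücker point, i.e. `P L` is the wedge product of the members of some (ordered) basis of `L`. -/
def IsPlueckerChoice {A : ℕ → Submodule K V} {ℓ : ℕ} (P : SchubertVariety A ℓ → ⋀[K]^ℓ V) : Prop :=
  ∀ L, ∃ v : Fin ℓ → V, LinearIndependent K v ∧ Submodule.span K (Set.range v) = L.1 ∧
    P L = exteriorPower.ιMulti K ℓ v

/-- The evaluation map `f ↦ c_f = (f ∧ P_L)_L`, from `⋀^(m-ℓ) V` to `K^Ω`, where `ℓ ≤ m` and `Ω`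
is the Schubert variety. The map `vol` identifies `⋀^m V` with `K`. -/
noncomputable def evalMap {A : ℕ → Submodule K V} {ℓ m : ℕ} (h : ℓ ≤ m)
    (vol : ⋀[K]^m V ≃ₗ[K] K) (P : SchubertVariety A ℓ → ⋀[K]^ℓ V) :
    ⋀[K]^(m - ℓ) V →ₗ[K] (SchubertVariety A ℓ → K) :=
  LinearMap.pi fun L => vol.toLinearMap ∘ₗ (wedge (Nat.sub_add_cancel h)).flip (P L)

/-- The Schubert code: the image of the evaluation map. -/
noncomputable def schubertCode {A : ℕ → Submodule K V} {ℓ m : ℕ} (h : ℓ ≤ m)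
    (vol : ⋀[K]^m V ≃ₗ[K] K) (P : SchubertVariety A ℓ → ⋀[K]^ℓ V) :
    Submodule K (SchubertVariety A ℓ → K) :=
  LinearMap.range (evalMap h vol P)

end Schubert

end SchubertCodes

/-! Evaluating `f` at Plücker points amounts to evaluating an alternating `ℓ`-form `φ`, so a weight
counts the points of the Schubert variety on which `φ` does not vanish. Replacing `f` by `f ∧ x`
contracts `φ` by `x` (`wedgeForm_wedgeVec`), which allows induction on `ℓ`.

The lower bound double counts pairs `(x, L')`, where `x ∈ A_ℓ` and `L'` is a point of the truncated
variety on which the contraction by `x` is nonzero. Such a pair spans a point `L = L' + ⟨x⟩` of the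
support of `φ`. Each `x ∉ E` lies in at least `D` pairs, `D` being a lower bound for the nonzero
weights one level down. If `x ∉ A_{ℓ-1}`, then `L' = L ∩ A_{ℓ-1}` is forced, so `L` arises from at
most `q^(ℓ-1) (q - 1)` pairs. If `x ∈ A_{ℓ-1}`, then `L ⊆ A_{ℓ-1}` and `L'` contains `L ∩ E`, of
codimension at most `t'` in `L`, so `L` arises from at most `q^(ℓ-1) (q^t' - 1)` pairs. Arithmetic
(`weight_bound_numerics`) turns this into the factor `q^(α_ℓ - ℓ)`.

For a minimum weight codeword all these inequalities are tight. Hence every nonzero contraction has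
weight exactly `D`, and only the two stated cases and `t' = 1` survive. The last is impossible for
geometric reasons (`not_finrank_contractionKernel_add_one`).

The bound is attained by the wedge of a basis of a subspace `U` of codimension `ℓ` with `dim (U ∩
A_i) = α_i - i`: its support consists of the points `L` with `L ∩ U = 0`, which are counted by
adding one vector per step of the flag. -/

namespace SchubertCodes

/-! ### Dimension counts for adjoining a vector -/

section Dimension

variable {K V : Type*} [Field K] [AddCommGroup V] [Module K V]

theorem sup_span_singleton_le {L M : Submodule K V} {x : V} (hL : L ≤ M) (hx : x ∈ M) :
    L ⊔ K ∙ x ≤ M :=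
  sup_le hL ((Submodule.span_singleton_le_iff_mem x M).2 hx)

theorem mem_sup_span_singleton_self (L : Submodule K V) (x : V) : x ∈ L ⊔ K ∙ x :=
  Submodule.mem_sup_right (Submodule.mem_span_singleton_self x)

variable [FiniteDimensional K V]

theorem finrank_sup_span_singleton {L : Submodule K V} {x : V} (hx : x ∉ L) :
    finrank K ↥(L ⊔ K ∙ x) = finrank K L + 1 := by
  have h := Submodule.finrank_sup_add_finrank_inf_eq L (K ∙ x)
  have hx0 : x ≠ 0 := fun h0 => hx (h0 ▸ L.zero_mem)
  have hinf : L ⊓ (K ∙ x) = ⊥ :=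
    disjoint_iff.1 ((Submodule.disjoint_span_singleton' hx0).2 hx)
  rw [hinf, finrank_bot, finrank_span_singleton hx0] at h
  omega

theorem sup_span_singleton_eq {L L' : Submodule K V} {x : V} {n : ℕ} (hL : finrank K L = n + 1)
    (hL' : finrank K L' = n) (hle : L' ≤ L) (hx : x ∈ L) (hx' : x ∉ L') : L' ⊔ K ∙ x = L :=
  Submodule.eq_of_le_of_finrank_le (sup_span_singleton_le hle hx)
    (by rw [finrank_sup_span_singleton hx', hL, hL'])

theorem finrank_add_finrank_le_of_le {L M N : Submodule K V} (hL : L ≤ N) (hM : M ≤ N) :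
    finrank K L + finrank K M ≤ finrank K N + finrank K ↥(L ⊓ M) := by
  rw [← Submodule.finrank_sup_add_finrank_inf_eq L M]
  exact Nat.add_le_add_right (Submodule.finrank_mono (sup_le hL hM)) _

theorem codimIn_add_finrank {U W : Submodule K V} (h : U ≤ W) :
    codimIn W U + finrank K U = finrank K W := by
  have h1 := Submodule.finrank_quotient_add_finrank (U.submoduleOf W)
  rwa [(Submodule.submoduleOfEquivOfLe h).finrank_eq] at h1

end Dimension

/-! ### Counting hyperplanes together with a vector off them -/

section HyperplaneCount

variable {K V : Type*} [Field K] [AddCommGroup V] [Module K V]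

theorem exists_dual_map_ker_eq [FiniteDimensional K V] {n : ℕ} {L L' : Submodule K V} {x : V}
    (hL : finrank K L = n + 1) (hL' : finrank K L' = n) (hle : L' ≤ L) (hx : x ∈ L)
    (hx' : x ∉ L') :
    ∃ g : Dual K L, g ⟨x, hx⟩ = 1 ∧ (LinearMap.ker g).map L.subtype = L' := by
  have hx'' : (⟨x, hx⟩ : L) ∉ L'.submoduleOf L := hx'
  obtain ⟨f, hf, hker⟩ := Submodule.exists_le_ker_of_notMem hx''
  refine ⟨(f ⟨x, hx⟩)⁻¹ • f, by simp [hf], ?_⟩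
  rw [LinearMap.ker_smul _ _ (inv_ne_zero hf)]
  symm
  apply Submodule.eq_of_le_of_finrank_le
  · intro y hy
    exact ⟨⟨y, hle hy⟩, hker (show y ∈ L' from hy), rfl⟩
  · have h1 : finrank K (LinearMap.ker f) < finrank K L := by
      apply Submodule.finrank_lt
      intro h
      exact hf (LinearMap.mem_ker.1 (h ▸ Submodule.mem_top : (⟨x, hx⟩ : L) ∈ LinearMap.ker f))
    rw [Submodule.finrank_map_subtype_eq, hL']
    omega

variable [FiniteDimensional K V]

theorem ncard_submodule (W : Submodule K V) :
    (W : Set V).ncard = Nat.card K ^ finrank K W :=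
  Module.natCard_eq_pow_finrank (K := K) (V := W)

variable [Finite K]

theorem ncard_dual_apply_eq_one_le {n : ℕ} (hV : finrank K V = n + 1) {g : Dual K V}
    (hg : g ≠ 0) : {x : V | g x = 1}.ncard ≤ Nat.card K ^ n := by
  have : Finite V := Module.finite_of_finite K
  rcases Set.eq_empty_or_nonempty {x : V | g x = 1} with h | ⟨x₀, hx₀⟩
  · simp [h]
  have hker : finrank K (LinearMap.ker g) = n := by
    have h1 := LinearMap.finrank_range_add_finrank_ker g
    rw [LinearMap.range_eq_top.2 (LinearMap.surjective hg), finrank_top, finrank_self] at h1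
    omega
  rw [← hker, ← ncard_submodule]
  refine Set.ncard_le_ncard_of_injOn (fun x => x - x₀) ?_ ?_ (Set.toFinite _)
  · intro x hx
    simp only [Set.mem_ofPred_eq] at hx hx₀
    simp [hx, hx₀]
  · intro x _ y _ h
    exact sub_left_injective h

/-- Pairs of a hyperplane of `V` and a vector off it, given by normalized functionals. -/
theorem ncard_dual_pairs_le {n s : ℕ} (hV : finrank K V = n + 1) (W : Submodule K V)
    (hs : n + 1 ≤ finrank K W + s) :
    {p : Dual K V × V | p.1 ∈ W.dualAnnihilator ∧ p.1 p.2 = 1}.ncard ≤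
      Nat.card K ^ n * (Nat.card K ^ s - 1) := by
  classical
  have : Finite V := Module.finite_of_finite K
  have : Finite (Dual K V) := Module.finite_of_finite K
  have hfin : {p : Dual K V × V | p.1 ∈ W.dualAnnihilator ∧ p.1 p.2 = 1}.Finite := Set.toFinite _
  have hfin' : ((W.dualAnnihilator : Set (Dual K V)) \ {0}).Finite := Set.toFinite _
  have hann : finrank K W.dualAnnihilator ≤ s := by
    have := Subspace.finrank_add_finrank_dualAnnihilator_eq W
    omega
  have hcard : hfin'.toFinset.card ≤ Nat.card K ^ s - 1 := by
    rw [← Set.ncard_eq_toFinset_card, Set.ncard_sdiff_singleton_of_mem (zero_mem _),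
      ncard_submodule]
    exact Nat.sub_le_sub_right (Nat.pow_le_pow_right Nat.card_pos hann) 1
  rw [Set.ncard_eq_toFinset_card _ hfin]
  -- Fibre over the functional: at most `q^s - 1` nonzero functionals kill `W`, and each takes the
  -- value `1` on at most `q^n` vectors.
  refine (Finset.card_le_mul_card_image_of_maps_to (f := Prod.fst) (t := hfin'.toFinset) ?_
    (Nat.card K ^ n) ?_).trans (Nat.mul_le_mul_left _ hcard)
  · rintro ⟨g, x⟩ h
    simp only [Set.Finite.mem_toFinset, Set.mem_ofPred_eq] at h ⊢
    refine ⟨h.1, ?_⟩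
    rintro rfl
    simpa using h.2
  · intro g hg
    simp only [Set.Finite.mem_toFinset] at hg
    refine le_trans ?_ (ncard_dual_apply_eq_one_le hV (g := g) hg.2)
    rw [Set.ncard_eq_toFinset_card _ (Set.toFinite _)]
    refine Finset.card_le_card_of_injOn Prod.snd ?_ ?_
    · rintro ⟨g', x⟩ h
      simp only [Finset.coe_filter, Set.Finite.mem_toFinset, Set.mem_ofPred_eq] at h
      obtain ⟨⟨-, h⟩, rfl⟩ := h
      simpa using h
    · rintro ⟨g₁, x⟩ h₁ ⟨g₂, y⟩ h₂ h
      simp only [Finset.coe_filter, Set.Finite.mem_toFinset, Set.mem_ofPred_eq] at h₁ h₂ h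
      rw [h₁.2, h₂.2, h]

/-- A hyperplane `L'` of `L` and a vector `x` off it determine the functional on `L` with kernel
`L'` and value `1` at `x`; this embeds the pairs into those of `ncard_dual_pairs_le`. -/
theorem ncard_hyperplane_pairs_le {n s : ℕ} {L W : Submodule K V} (hL : finrank K L = n + 1)
    (hW : W ≤ L) (hs : n + 1 ≤ finrank K W + s) :
    {p : V × Submodule K V | finrank K p.2 = n ∧ W ≤ p.2 ∧ p.2 ≤ L ∧ p.1 ∈ L ∧ p.1 ∉ p.2}.ncard ≤
      Nat.card K ^ n * (Nat.card K ^ s - 1) := by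
  classical
  have : Finite V := Module.finite_of_finite K
  have : Finite (Dual K L) := Module.finite_of_finite K
  have hs' : n + 1 ≤ finrank K (W.submoduleOf L) + s := by
    rwa [(Submodule.submoduleOfEquivOfLe hW).finrank_eq]
  refine le_trans ?_ (ncard_dual_pairs_le hL (W.submoduleOf L) hs')
  have key : ∀ p ∈ {p : V × Submodule K V |
      finrank K p.2 = n ∧ W ≤ p.2 ∧ p.2 ≤ L ∧ p.1 ∈ L ∧ p.1 ∉ p.2},
      ∃ r : Dual K L × L, (r.1 ∈ (W.submoduleOf L).dualAnnihilator ∧ r.1 r.2 = 1) ∧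
        (r.2 : V) = p.1 ∧ (LinearMap.ker r.1).map L.subtype = p.2 := by
    rintro ⟨x, L'⟩ ⟨h1, h2, h3, h4, h5⟩
    obtain ⟨g, hg, hker⟩ := exists_dual_map_ker_eq hL h1 h3 h4 h5
    refine ⟨(g, ⟨x, h4⟩), ⟨?_, hg⟩, rfl, hker⟩
    rw [Submodule.mem_dualAnnihilator]
    intro w hw
    have hw' : (w : V) ∈ (LinearMap.ker g).map L.subtype := hker ▸ h2 hw
    obtain ⟨w', hw', hww⟩ := hw'
    rw [← Subtype.ext (hww : (w' : V) = w)]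
    exact hw'
  choose! r hr using key
  refine Set.ncard_le_ncard_of_injOn r (fun p hp => (hr p hp).1) ?_ (Set.toFinite _)
  intro p hp p' hp' h
  refine Prod.ext ?_ ?_
  · rw [← (hr p hp).2.1, ← (hr p' hp').2.1, h]
  · rw [← (hr p hp).2.2, ← (hr p' hp').2.2, h]

end HyperplaneCount

/-! ### Schubert varieties and supports of alternating forms -/

section SchubertSet

variable {K V : Type*} [Field K] [AddCommGroup V] [Module K V]

/-- The points of the Schubert variety of the first `n` members of `B`, as a set of subspaces. -/
def schubertSet (B : ℕ → Submodule K V) (n : ℕ) : Set (Submodule K V) :=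
  {L | finrank K L = n ∧ ∀ i ≤ n, i ≤ finrank K ↥(L ⊓ B i)}

/-- The points of the Schubert variety on which the alternating form `φ` does not vanish. -/
def formSupport (B : ℕ → Submodule K V) {n : ℕ} (φ : V [⋀^Fin n]→ₗ[K] K) :
    Set (Submodule K V) :=
  {L | L ∈ schubertSet B n ∧ ∃ v : Fin n → V, (∀ i, v i ∈ L) ∧ φ v ≠ 0}

variable {B : ℕ → Submodule K V} {n : ℕ}

theorem linearIndependent_of_apply_ne_zero {φ : V [⋀^Fin n]→ₗ[K] K} {v : Fin n → V}
    (h : φ v ≠ 0) : LinearIndependent K v := by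
  by_contra h'
  exact h (φ.map_linearDependent v h')

variable [FiniteDimensional K V]

theorem le_of_mem_schubertSet {L : Submodule K V} (hL : L ∈ schubertSet B n) : L ≤ B n := by
  have h := Submodule.eq_of_le_of_finrank_le (inf_le_left : L ⊓ B n ≤ L)
    (by rw [hL.1]; exact hL.2 n le_rfl)
  exact inf_eq_left.1 h

theorem sup_span_singleton_mem_schubertSet {L : Submodule K V} {x : V}
    (hB : B n ≤ B (n + 1)) (hL : L ∈ schubertSet B n) (hx : x ∈ B (n + 1)) (hxL : x ∉ L) :
    L ⊔ K ∙ x ∈ schubertSet B (n + 1) := by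
  have hfin : finrank K ↥(L ⊔ K ∙ x) = n + 1 := by rw [finrank_sup_span_singleton hxL, hL.1]
  refine ⟨hfin, fun i hi => ?_⟩
  rcases Nat.lt_or_ge n i with h | h
  · obtain rfl : i = n + 1 := by omega
    rw [inf_eq_left.2 (sup_span_singleton_le ((le_of_mem_schubertSet hL).trans hB) hx), hfin]
  · exact (hL.2 i h).trans (Submodule.finrank_mono (inf_le_inf_right _ le_sup_left))

/-- Greedy choice: as long as `M` has dimension `n`, the space `L ⊓ B (n + 1)` is too large to lie
in it and supplies the next vector. -/
theorem exists_le_mem_schubertSet (hB : MonotoneOn B (Set.Iic n)) {L : Submodule K V}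
    (hL : ∀ i ≤ n, i ≤ finrank K ↥(L ⊓ B i)) : ∃ M ≤ L, M ∈ schubertSet B n := by
  induction n with
  | zero => exact ⟨⊥, bot_le, finrank_bot K V, by simp⟩
  | succ n ih =>
    obtain ⟨M, hML, hM⟩ := ih (hB.mono (Set.Iic_subset_Iic.2 n.le_succ))
      fun i hi => hL i (hi.trans n.le_succ)
    have hBn : B n ≤ B (n + 1) := hB (by simp) (by simp) n.le_succ
    obtain ⟨x, ⟨hxL, hxB⟩, hxM⟩ : ∃ x ∈ L ⊓ B (n + 1), x ∉ M := by
      by_contra! h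
      have h1 := Submodule.finrank_mono (show L ⊓ B (n + 1) ≤ M from h)
      have h2 := hL (n + 1) le_rfl
      rw [hM.1] at h1
      omega
    exact ⟨M ⊔ K ∙ x, sup_span_singleton_le hML hxL,
      sup_span_singleton_mem_schubertSet hBn hM hxB hxM⟩

/-- A form which does not vanish on an `n`-dimensional space is nonzero on each of its bases. -/
theorem apply_ne_zero_of_linearIndependent {φ : V [⋀^Fin n]→ₗ[K] K} {L : Submodule K V}
    (hL : finrank K L = n) {v w : Fin n → V} (hv : ∀ i, v i ∈ L) (hφ : φ v ≠ 0)
    (hw : ∀ i, w i ∈ L) (hwi : LinearIndependent K w) : φ w ≠ 0 := by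
  let w' : Fin n → L := fun i => ⟨w i, hw i⟩
  have hw' : LinearIndependent K w' := LinearIndependent.of_comp L.subtype hwi
  let b : Basis (Fin n) K L := basisOfLinearIndependentOfCardEqFinrank' w' hw' (by simp [hL])
  have h1 : (φ.compLinearMap L.subtype) b ≠ 0 := by
    rw [AlternatingMap.map_basis_ne_zero_iff]
    intro h
    exact hφ (DFunLike.congr_fun h fun i => (⟨v i, hv i⟩ : L))
  simpa [b, w', Function.comp_def] using h1

/-- On an `(n + 1)`-dimensional space, `φ` is nonzero either on all bases or on none, so it may be
tested on a basis that starts with `x` and continues in `L`. This links the supports of `φ` and of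
its contractions. -/
theorem mem_formSupport_curryLeft_iff {φ : V [⋀^Fin (n + 1)]→ₗ[K] K} {L : Submodule K V} {x : V}
    (hB : B n ≤ B (n + 1)) (hL : L ∈ schubertSet B n) (hx : x ∈ B (n + 1)) :
    L ∈ formSupport B (φ.curryLeft x) ↔ x ∉ L ∧ L ⊔ K ∙ x ∈ formSupport B φ := by
  constructor
  · rintro ⟨-, v, hv, hφ⟩
    rw [AlternatingMap.curryLeft_apply_apply] at hφ
    have hli := linearIndependent_of_apply_ne_zero hφ
    obtain ⟨hli', hxv⟩ := linearIndependent_finCons.1 hli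
    have hspan : Submodule.span K (Set.range v) = L :=
      Submodule.eq_of_le_of_finrank_le (Submodule.span_le.2 (Set.range_subset_iff.2 hv))
        (by rw [finrank_span_eq_card hli', hL.1, Fintype.card_fin])
    rw [hspan] at hxv
    refine ⟨hxv, sup_span_singleton_mem_schubertSet hB hL hx hxv, _, ?_, hφ⟩
    intro i
    refine Fin.cases ?_ (fun j => ?_) i
    · exact mem_sup_span_singleton_self L x
    · exact Submodule.mem_sup_left (hv j)
  · rintro ⟨hxL, hS, v, hv, hφ⟩
    let b := finBasisOfFinrankEq K L hL.1
    have hb : LinearIndependent K fun i => (b i : V) :=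
      b.linearIndependent.map' L.subtype (Submodule.ker_subtype L)
    have hspan : Submodule.span K (Set.range fun i => (b i : V)) ≤ L :=
      Submodule.span_le.2 (Set.range_subset_iff.2 fun i => (b i).2)
    refine ⟨hL, fun i => b i, fun i => (b i).2, ?_⟩
    rw [AlternatingMap.curryLeft_apply_apply]
    refine apply_ne_zero_of_linearIndependent hS.1 hv hφ ?_
      (linearIndependent_finCons.2 ⟨hb, fun h => hxL (hspan h)⟩)
    intro i
    refine Fin.cases ?_ (fun j => ?_) i
    · exact mem_sup_span_singleton_self L x
    · exact Submodule.mem_sup_left (b j).2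

end SchubertSet

/-! ### The kernel of the contraction, and the double count -/

section Contraction

variable {K V : Type*} [Field K] [AddCommGroup V] [Module K V]

/-- The vectors of `B (n + 1)` by which the contraction of `φ` vanishes on the Schubert variety of
the first `n` members of `B`. -/
def contractionKernel (B : ℕ → Submodule K V) {n : ℕ} (φ : V [⋀^Fin (n + 1)]→ₗ[K] K) :
    Submodule K V where
  carrier := {x | x ∈ B (n + 1) ∧ ∀ L ∈ schubertSet B n, ∀ v : Fin n → V, (∀ i, v i ∈ L) →
    φ.curryLeft x v = 0}
  zero_mem' := ⟨zero_mem _, by simp⟩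
  add_mem' := fun hx hy => ⟨add_mem hx.1 hy.1, fun L hL v hv => by
    rw [map_add, AlternatingMap.add_apply, hx.2 L hL v hv, hy.2 L hL v hv, add_zero]⟩
  smul_mem' := fun a x hx => ⟨Submodule.smul_mem _ a hx.1, fun L hL v hv => by
    rw [map_smul, AlternatingMap.smul_apply, hx.2 L hL v hv, smul_zero]⟩

variable {B : ℕ → Submodule K V} {n : ℕ} {φ : V [⋀^Fin (n + 1)]→ₗ[K] K}

theorem contractionKernel_le : contractionKernel B φ ≤ B (n + 1) := fun _ hx => hx.1

theorem mem_contractionKernel_iff {x : V} :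
    x ∈ contractionKernel B φ ↔ x ∈ B (n + 1) ∧ formSupport B (φ.curryLeft x) = ∅ := by
  constructor
  · rintro ⟨hx, h⟩
    refine ⟨hx, Set.eq_empty_of_forall_notMem ?_⟩
    rintro L ⟨hL, v, hv, hne⟩
    exact hne (h L hL v hv)
  · rintro ⟨hx, h⟩
    refine ⟨hx, fun L hL v hv => ?_⟩
    by_contra hne
    exact (h ▸ ⟨hL, v, hv, hne⟩ : L ∈ (∅ : Set (Submodule K V)))

theorem notMem_contractionKernel {L : Submodule K V} {x : V}
    (hL : L ∈ formSupport B (φ.curryLeft x)) : x ∉ contractionKernel B φ := fun h =>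
  Set.notMem_empty L ((mem_contractionKernel_iff.1 h).2 ▸ hL)

/-- The pairs `(x, L)` with `x ∈ X` such that the contraction of `φ` by `x` does not vanish on the
point `L` of the Schubert variety. -/
def contractionPairs (B : ℕ → Submodule K V) {n : ℕ} (φ : V [⋀^Fin (n + 1)]→ₗ[K] K) (X : Set V) :
    Set (V × Submodule K V) :=
  {p | p.1 ∈ X ∧ p.2 ∈ formSupport B (φ.curryLeft p.1)}

variable [FiniteDimensional K V]

/-- A vector `x` of `L` off `L'` gives `L = L' + ⟨x⟩`, so the contraction by `x` is nonzero on `L'`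
and `x` is not in the kernel. This is what limits the possible `L'` in the double count. -/
theorem inf_contractionKernel_le {L L' : Submodule K V}
    (hB : B n ≤ B (n + 1)) (hL : L ∈ formSupport B φ) (hL' : L' ∈ schubertSet B n) (hle : L' ≤ L) :
    L ⊓ contractionKernel B φ ≤ L' := by
  rintro x ⟨hxL, hx⟩
  by_contra hxL'
  refine notMem_contractionKernel (L := L') ?_ hx
  rw [mem_formSupport_curryLeft_iff hB hL' hx.1, sup_span_singleton_eq hL.1.1 hL'.1 hle hxL hxL']
  exact ⟨hxL', hL⟩

/-- Otherwise a support point `L` would lie in the kernel, hence in any of its hyperplanes `L'`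
belonging to the truncated variety. -/
theorem contractionKernel_lt (hB : MonotoneOn B (Set.Iic (n + 1))) (h : (formSupport B φ).Nonempty) :
    contractionKernel B φ < B (n + 1) := by
  obtain ⟨L, hL⟩ := h
  obtain ⟨L', hle, hL'⟩ := exists_le_mem_schubertSet (hB.mono (Set.Iic_subset_Iic.2 n.le_succ))
    fun i hi => hL.1.2 i (hi.trans n.le_succ)
  have hBn : B n ≤ B (n + 1) := hB (by simp) (by simp) n.le_succ
  refine lt_of_le_of_ne contractionKernel_le fun heq => ?_
  have h1 := inf_contractionKernel_le hBn hL hL' hle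
  rw [heq, inf_eq_left.2 (le_of_mem_schubertSet hL.1)] at h1
  have h2 := Submodule.finrank_mono h1
  rw [hL.1.1, hL'.1] at h2
  omega

section Count

variable [Finite K]

theorem ncard_contractionPairs_le_of_maps {X : Set V} {S : Set (Submodule K V)} {N : ℕ}
    (hS : ∀ p ∈ contractionPairs B φ X, p.2 ⊔ K ∙ p.1 ∈ S)
    (hN : ∀ L ∈ S, {p ∈ contractionPairs B φ X | p.2 ⊔ K ∙ p.1 = L}.ncard ≤ N) :
    (contractionPairs B φ X).ncard ≤ N * S.ncard := by
  classical
  have : Finite V := Module.finite_of_finite K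
  rw [Set.ncard_eq_toFinset_card _ (Set.toFinite (contractionPairs B φ X)),
    Set.ncard_eq_toFinset_card _ (Set.toFinite S)]
  refine Finset.card_le_mul_card_image_of_maps_to (f := fun p => p.2 ⊔ K ∙ p.1) ?_ N ?_
  · intro p hp
    exact (Set.Finite.mem_toFinset _).2 (hS p ((Set.Finite.mem_toFinset _).1 hp))
  · intro L hL
    refine le_trans (le_of_eq ?_) (hN L ((Set.Finite.mem_toFinset _).1 hL))
    rw [Set.ncard_eq_toFinset_card _ (Set.toFinite _)]
    congr 1
    ext p
    simp

/-- Since `L` is not inside `B n`, the intersection `L ⊓ B n` has dimension exactly `n` and must be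
`L'`; only the choice of `x` off it remains. -/
theorem ncard_contractionPairs_compl_le (hB : B n ≤ B (n + 1)) :
    (contractionPairs B φ ((B (n + 1) : Set V) \ B n)).ncard ≤
      Nat.card K ^ n * (Nat.card K - 1) * {L ∈ formSupport B φ | ¬ L ≤ B n}.ncard := by
  have : Finite V := Module.finite_of_finite K
  apply ncard_contractionPairs_le_of_maps
  · rintro ⟨x, L'⟩ ⟨hx, hL'⟩
    exact ⟨((mem_formSupport_curryLeft_iff hB hL'.1 hx.1).1 hL').2,
      fun h => hx.2 (h (mem_sup_span_singleton_self L' x))⟩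
  · rintro L ⟨hL, hLB⟩
    have hW : n + 1 ≤ finrank K ↥(L ⊓ B n) + 1 := by
      have := hL.1.2 n n.le_succ
      omega
    have hlt : finrank K ↥(L ⊓ B n) < n + 1 := by
      rw [← hL.1.1]
      exact Submodule.finrank_lt_finrank_of_lt (inf_lt_left.2 hLB)
    have key := ncard_hyperplane_pairs_le hL.1.1 (inf_le_left : L ⊓ B n ≤ L) hW
    rw [pow_one] at key
    refine le_trans (Set.ncard_le_ncard ?_ (Set.toFinite _)) key
    rintro ⟨x, L'⟩ ⟨⟨hx, hL'⟩, hsup⟩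
    have hxL' := ((mem_formSupport_curryLeft_iff hB hL'.1 hx.1).1 hL').1
    simp only at hsup hL' hx
    have hle : L' ≤ L := hsup ▸ le_sup_left
    have heq : L' = L ⊓ B n := Submodule.eq_of_le_of_finrank_le
      (le_inf hle (le_of_mem_schubertSet hL'.1)) (by rw [hL'.1.1]; omega)
    exact ⟨hL'.1.1, heq.ge, hle, hsup ▸ mem_sup_span_singleton_self L' x, hxL'⟩

/-- Here `L ≤ B n`, so `L` meets the kernel in codimension at most `t`, and `L'` is a hyperplane of
`L` containing that intersection. -/
theorem ncard_contractionPairs_le {t : ℕ} (hB : B n ≤ B (n + 1))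
    (ht : finrank K (B n) ≤ finrank K ↥(contractionKernel B φ ⊓ B n) + t) :
    (contractionPairs B φ (B n)).ncard ≤
      Nat.card K ^ n * (Nat.card K ^ t - 1) * {L ∈ formSupport B φ | L ≤ B n}.ncard := by
  have : Finite V := Module.finite_of_finite K
  apply ncard_contractionPairs_le_of_maps
  · rintro ⟨x, L'⟩ ⟨hx, hL'⟩
    exact ⟨((mem_formSupport_curryLeft_iff hB hL'.1 (hB hx)).1 hL').2,
      sup_span_singleton_le (le_of_mem_schubertSet hL'.1) hx⟩
  · rintro L ⟨hL, hLB⟩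
    have hW : n + 1 ≤ finrank K ↥(L ⊓ contractionKernel B φ) + t := by
      have h1 := finrank_add_finrank_le_of_le hLB
        (inf_le_right : contractionKernel B φ ⊓ B n ≤ B n)
      have h2 : finrank K ↥(L ⊓ (contractionKernel B φ ⊓ B n)) ≤
          finrank K ↥(L ⊓ contractionKernel B φ) :=
        Submodule.finrank_mono (inf_le_inf_left _ inf_le_left)
      rw [hL.1.1] at h1
      omega
    refine le_trans (Set.ncard_le_ncard ?_ (Set.toFinite _))
      (ncard_hyperplane_pairs_le hL.1.1 inf_le_left hW)
    rintro ⟨x, L'⟩ ⟨⟨hx, hL'⟩, hsup⟩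
    have hxL' := ((mem_formSupport_curryLeft_iff hB hL'.1 (hB hx)).1 hL').1
    simp only at hsup hL' hx
    have hle : L' ≤ L := hsup ▸ le_sup_left
    exact ⟨hL'.1.1, inf_contractionKernel_le hB hL hL'.1 hle, hle,
      hsup ▸ mem_sup_span_singleton_self L' x, hxL'⟩

theorem ncard_contractionPairs (X : Finset V) :
    (contractionPairs B φ X).ncard = ∑ x ∈ X, (formSupport B (φ.curryLeft x)).ncard := by
  classical
  have : Finite V := Module.finite_of_finite K
  rw [Set.ncard_eq_toFinset_card _ (Set.toFinite _),
    Finset.card_eq_sum_card_fiberwise (f := Prod.fst) (t := X)]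
  · refine Finset.sum_congr rfl fun x hx => ?_
    rw [Set.ncard_eq_toFinset_card _ (Set.toFinite _)]
    refine Finset.card_nbij' (fun p => p.2) (fun L => (x, L)) ?_ ?_ ?_ ?_
    · rintro ⟨y, L⟩ h
      simp only [Finset.coe_filter, Set.Finite.mem_toFinset, Set.mem_ofPred_eq] at h
      obtain ⟨h, rfl⟩ := h
      simpa using h.2
    · intro L h
      simp only [Set.Finite.coe_toFinset] at h
      simpa using ⟨hx, h⟩
    · rintro ⟨y, L⟩ h
      simp only [Finset.coe_filter, Set.Finite.mem_toFinset, Set.mem_ofPred_eq] at h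
      simp [h.2]
    · intro L _
      rfl
  · rintro p hp
    simp only [Set.Finite.coe_toFinset] at hp
    exact hp.1

end Count

/-- The trace on `B (n + 1)` of the kernel of the contraction does not have codimension `1`. -/
theorem not_finrank_contractionKernel_add_one (hB : MonotoneOn B (Set.Iic (n + 2)))
    {φ : V [⋀^Fin (n + 2)]→ₗ[K] K} :
    ¬ finrank K ↥(contractionKernel B φ ⊓ B (n + 1)) + 1 = finrank K (B (n + 1)) := by
  intro h
  have hB1 : B n ≤ B (n + 1) := hB (by simp) (by simp) (by omega)
  have hB2 : B (n + 1) ≤ B (n + 2) := hB (by simp) (by simp) (by omega)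
  obtain ⟨y, hyB, hy⟩ : ∃ y ∈ B (n + 1), y ∉ contractionKernel B φ := by
    by_contra! hle
    rw [inf_eq_right.2 (show B (n + 1) ≤ contractionKernel B φ from hle)] at h
    omega
  have hne : (formSupport B (φ.curryLeft y)).Nonempty := by
    rw [Set.nonempty_iff_ne_empty]
    exact fun h0 => hy (mem_contractionKernel_iff.2 ⟨hB2 hyB, h0⟩)
  -- The kernel cuts a hyperplane on `B (n + 1)`, so it meets `L + ⟨y⟩` in dimension at least `n +
  -- 1`; this intersection lies in `L`, hence equals `L`.
  have hle : ∀ L ∈ formSupport B (φ.curryLeft y), L ≤ contractionKernel B φ := by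
    intro L hL
    obtain ⟨hyL, hS⟩ := (mem_formSupport_curryLeft_iff hB2 hL.1 (hB2 hyB)).1 hL
    have hW := inf_contractionKernel_le hB2 hS hL.1 le_sup_left
    have h1 := finrank_add_finrank_le_of_le
      (sup_span_singleton_le (le_of_mem_schubertSet hL.1) hyB)
      (inf_le_right : contractionKernel B φ ⊓ B (n + 1) ≤ B (n + 1))
    have h2 : finrank K ↥((L ⊔ K ∙ y) ⊓ (contractionKernel B φ ⊓ B (n + 1))) ≤
        finrank K ↥((L ⊔ K ∙ y) ⊓ contractionKernel B φ) :=
      Submodule.finrank_mono (inf_le_inf_left _ inf_le_left)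
    have h3 := hL.1.1
    have h4 := hS.1.1
    have heq := Submodule.eq_of_le_of_finrank_le hW (by omega)
    exact heq ▸ inf_le_right
  obtain ⟨L, hL⟩ := hne
  obtain ⟨hyL, hS⟩ := (mem_formSupport_curryLeft_iff hB2 hL.1 (hB2 hyB)).1 hL
  obtain ⟨M, hML, hM⟩ := exists_le_mem_schubertSet
    (hB.mono (Set.Iic_subset_Iic.2 (by omega : n ≤ n + 2)))
    fun i hi => hL.1.2 i (hi.trans n.le_succ)
  obtain ⟨z, hzL, hzM⟩ : ∃ z ∈ L, z ∉ M := by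
    by_contra! hle
    have h1 := Submodule.finrank_mono (show L ≤ M from hle)
    rw [hM.1, hL.1.1] at h1
    omega
  have hLM : M ⊔ K ∙ z = L := sup_span_singleton_eq hL.1.1 hM.1 hML hzL hzM
  -- Tilt `L = M + ⟨z⟩` to `M + ⟨z + y⟩`. This is again a Schubert point spanning the same space
  -- with `y`, so it also lies in the kernel, which then contains `z`, `z + y` and therefore `y`.
  have hzy : z + y ∉ M := fun h1 => hyL ((Submodule.add_mem_iff_right L hzL).1 (hML h1))
  have hM' := sup_span_singleton_mem_schubertSet hB1 hM
    (add_mem (le_of_mem_schubertSet hL.1 hzL) hyB) hzy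
  have hzyM := mem_sup_span_singleton_self M (z + y)
  have hsub : M ⊔ K ∙ (z + y) ≤ L ⊔ K ∙ y :=
    sup_span_singleton_le (hML.trans le_sup_left)
      (add_mem (Submodule.mem_sup_left hzL) (mem_sup_span_singleton_self L y))
  have hyM' : y ∉ M ⊔ K ∙ (z + y) := by
    intro hy'
    have hz' : z ∈ M ⊔ K ∙ (z + y) := (Submodule.add_mem_iff_left _ hy').1 hzyM
    have h1 : L ⊔ K ∙ y ≤ M ⊔ K ∙ (z + y) :=
      sup_span_singleton_le (hLM ▸ sup_span_singleton_le le_sup_left hz') hy'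
    have h2 := Submodule.finrank_mono h1
    rw [hM'.1, hS.1.1] at h2
    omega
  have hsup := sup_span_singleton_eq hS.1.1 hM'.1 hsub (mem_sup_span_singleton_self L y) hyM'
  have hmem : M ⊔ K ∙ (z + y) ∈ formSupport B (φ.curryLeft y) := by
    rw [mem_formSupport_curryLeft_iff hB2 hM' (hB2 hyB), hsup]
    exact ⟨hyM', hS⟩
  exact hy ((Submodule.add_mem_iff_right _ (hle L hL hzL)).1 (hle _ hmem hzyM))

end Contraction

/-! ### Arithmetic of the double count -/

section Numerics

/-- For `c ≤ d` compare factor by factor. For `d < c` expand: the leading powers compare by `h`, and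
the subtracted power is strictly larger on the left, so equality cannot occur. -/
theorem pow_mul_pow_sub_one_le {q c d s s' : ℕ} (hq : 2 ≤ q) (hs : s' ≤ s) (h : s' + c ≤ s + d) :
    q ^ c * ((q : ℚ) ^ s' - 1) ≤ q ^ d * ((q : ℚ) ^ s - 1) ∧
      (q ^ c * ((q : ℚ) ^ s' - 1) = q ^ d * ((q : ℚ) ^ s - 1) → s' = 0 ∨ s' = s ∧ c = d) := by
  have hq1 : (1 : ℚ) < q := by exact_mod_cast hq
  have hc : (0 : ℚ) < q ^ c := by positivity
  have hd : (0 : ℚ) < q ^ d := by positivity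
  have hs1 : (q : ℚ) ^ s' ≤ q ^ s := pow_le_pow_right₀ hq1.le hs
  have hs2 : (1 : ℚ) ≤ q ^ s' := one_le_pow₀ hq1.le
  rcases Nat.lt_or_ge d c with hdc | hcd
  · have h1 : (q : ℚ) ^ (s' + c) ≤ q ^ (s + d) := pow_le_pow_right₀ hq1.le h
    have h2 : (q : ℚ) ^ d < q ^ c := pow_lt_pow_right₀ hq1 hdc
    rw [pow_add, pow_add] at h1
    exact ⟨by linarith, fun h3 => by linarith⟩
  · have hcd' : (q : ℚ) ^ c ≤ q ^ d := pow_le_pow_right₀ hq1.le hcd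
    have h1 : (q : ℚ) ^ c * ((q : ℚ) ^ s' - 1) ≤ q ^ d * (q ^ s' - 1) :=
      mul_le_mul_of_nonneg_right hcd' (by linarith)
    have h2 : (q : ℚ) ^ d * ((q : ℚ) ^ s' - 1) ≤ q ^ d * (q ^ s - 1) :=
      mul_le_mul_of_nonneg_left (by linarith) hd.le
    refine ⟨h1.trans h2, fun h3 => ?_⟩
    have h4 : (q : ℚ) ^ s' - 1 = q ^ s - 1 := mul_left_cancel₀ hd.ne' (by linarith)
    have h5 : s' = s := pow_right_injective₀ (by linarith) hq1.ne' (by simpa using h4)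
    rcases Nat.eq_zero_or_pos s' with h0 | h0
    · exact Or.inl h0
    · have h6 : (1 : ℚ) < q ^ s' := one_lt_pow₀ hq1 h0.ne'
      have h7 : (q : ℚ) ^ c = q ^ d :=
        mul_right_cancel₀ (show (q : ℚ) ^ s' - 1 ≠ 0 by linarith) (by linarith)
      exact Or.inr ⟨h5, pow_right_injective₀ (by linarith) hq1.ne' h7⟩

/-- The arithmetic of the double count: `X` and `Y` count the points of the support which are not,
respectively are, contained in the last but one member of the flag. -/
theorem weight_bound_numerics {q n a b a' b' c t t' : ℕ} {X Y To Ti D Fo Fi : ℚ} (hq : 2 ≤ q)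
    (hc : a = c + n + 1) (ha : a = t + a') (hb : b = t' + b') (hba : b < a) (ht : 1 ≤ t)
    (htt : t' ≤ t) (hD : 0 < D) (hY : 0 ≤ Y)
    (hFi : Fi = (q : ℚ) ^ b - q ^ b') (hFo : Fo = (q : ℚ) ^ a - q ^ a' - Fi)
    (hTo : To ≤ q ^ n * ((q : ℚ) - 1) * X) (hTi : Ti ≤ q ^ n * ((q : ℚ) ^ t' - 1) * Y)
    (hDo : D * Fo ≤ To) (hDi : D * Fi ≤ Ti) :
    D * q ^ c ≤ X + Y ∧ (X + Y = D * q ^ c → To = D * Fo ∧ Ti = D * Fi ∧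
      (t = 1 ∧ t' = 0 ∨ t' = 1 ∨ t' = t ∧ 2 ≤ t ∧ a = b + 1 ∧
        X + Y = To / (q ^ n * ((q : ℚ) - 1)) + Ti / (q ^ n * ((q : ℚ) ^ t - 1)))) := by
  have hq1 : (1 : ℚ) < q := by exact_mod_cast hq
  have hN : (0 : ℚ) < q ^ n := by positivity
  have hN1 : (0 : ℚ) < q ^ n * (q - 1) := mul_pos hN (by linarith)
  have hac : (q : ℚ) ^ a = q ^ n * q * q ^ c := by rw [hc]; ring
  rcases Nat.eq_zero_or_pos t' with ht' | ht'
  · subst ht'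
    obtain rfl : b = b' := by omega
    have hFi0 : Fi = 0 := by rw [hFi]; ring
    have hTi0 : Ti = 0 := by
      simp only [pow_zero, sub_self, mul_zero, zero_mul] at hTi
      rw [hFi0, mul_zero] at hDi
      exact le_antisymm hTi hDi
    have hgap : (q : ℚ) ^ a' ≤ q ^ n * q ^ c := by
      rw [← pow_add]
      exact pow_le_pow_right₀ hq1.le (by omega)
    have hYN : 0 ≤ q ^ n * ((q : ℚ) - 1) * Y := by positivity
    -- The excess is written as a sum of nonnegative terms, so equality kills each of them. The last
    -- term vanishes only for `a' = a - 1`, that is `t = 1`.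
    have hid : q ^ n * ((q : ℚ) - 1) * (X + Y - D * q ^ c) =
        (q ^ n * ((q : ℚ) - 1) * X - To) + q ^ n * ((q : ℚ) - 1) * Y + (To - D * Fo) +
          D * (q ^ n * q ^ c - q ^ a') := by
      rw [hFo, hFi0, hac]; ring
    have hgap' : 0 ≤ D * ((q : ℚ) ^ n * q ^ c - q ^ a') := mul_nonneg hD.le (by linarith)
    refine ⟨?_, fun heq => ?_⟩
    · have : 0 ≤ X + Y - D * q ^ c := nonneg_of_mul_nonneg_right (by linarith) hN1
      linarith
    · rw [heq, sub_self, mul_zero] at hid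
      refine ⟨by linarith, by rw [hTi0, hFi0, mul_zero], Or.inl ⟨?_, rfl⟩⟩
      have h1 : D * ((q : ℚ) ^ n * q ^ c - q ^ a') = 0 := by linarith
      have h2 : (q : ℚ) ^ (n + c) = q ^ a' := by
        rw [pow_add]
        linarith [(mul_eq_zero.1 h1).resolve_left hD.ne']
      have h3 := pow_right_injective₀ (by linarith) hq1.ne' h2
      omega
  · obtain ⟨s', rfl⟩ : ∃ s', t' = s' + 1 := ⟨t' - 1, by omega⟩
    obtain ⟨s, rfl⟩ : ∃ s, t = s + 1 := ⟨t - 1, by omega⟩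
    -- The exponent condition reads `b ≤ a - 1`, because `s' + b' + 1 = b` and `s + a' = a - 1`.
    obtain ⟨hle, heqc⟩ := pow_mul_pow_sub_one_le (c := b' + 1) (d := a') (s := s) (s' := s') hq
      (by omega) (by omega)
    have hR : 0 < (q : ℚ) ^ (s' + 1) - 1 := by
      have : (1 : ℚ) < q ^ (s' + 1) := one_lt_pow₀ hq1 (by omega)
      linarith
    set R := (q : ℚ) ^ (s' + 1) - 1 with hRdef
    have hFiR : Fi = q ^ b' * R := by rw [hFi, hb, hRdef]; ring
    -- Dividing the inner sum by `q^t' - 1` puts its bounds on the scale of `Y`, so that they can be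
    -- added to the outer ones with weight `q - 1`.
    obtain ⟨y, hy⟩ : ∃ y, Ti = y * R := ⟨Ti / R, (div_mul_cancel₀ _ hR.ne').symm⟩
    have hy1 : y ≤ q ^ n * Y := by
      refine le_of_mul_le_mul_right ?_ hR
      linarith
    have hy2 : D * q ^ b' ≤ y := by
      refine le_of_mul_le_mul_right ?_ hR
      rw [← hy, mul_assoc, ← hFiR]
      exact hDi
    have haa : (q : ℚ) ^ n * q ^ c = q ^ s * q ^ a' := by
      rw [← pow_add, ← pow_add]
      congr 1
      omega
    -- Again a sum of nonnegative slacks: two for the fibre bounds, two for the lower bound `D` on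
    -- weights, and one for the dimensions.
    have hid : q ^ n * ((q : ℚ) - 1) * (X + Y - D * q ^ c) =
        (q ^ n * ((q : ℚ) - 1) * X - To) + (q - 1) * (q ^ n * Y - y) + (To - D * Fo) +
          (q - 1) * (y - D * q ^ b') +
          D * (q ^ a' * ((q : ℚ) ^ s - 1) - q ^ (b' + 1) * (q ^ s' - 1)) := by
      have h1 : (q : ℚ) ^ a' * ((q : ℚ) ^ s - 1) = q ^ n * q ^ c - q ^ a' := by rw [haa]; ring
      rw [hFo, hFiR, hRdef, hac, h1]; ring
    have h1 : 0 ≤ ((q : ℚ) - 1) * (q ^ n * Y - y) := mul_nonneg (by linarith) (by linarith)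
    have h2 : 0 ≤ ((q : ℚ) - 1) * (y - D * q ^ b') := mul_nonneg (by linarith) (by linarith)
    have h3 : 0 ≤ D * (q ^ a' * ((q : ℚ) ^ s - 1) - q ^ (b' + 1) * (q ^ s' - 1)) :=
      mul_nonneg hD.le (by linarith)
    refine ⟨?_, fun heq => ?_⟩
    · have : 0 ≤ X + Y - D * q ^ c := nonneg_of_mul_nonneg_right (by linarith) hN1
      linarith
    · have hid' := hid
      rw [heq, sub_self, mul_zero] at hid'
      have e1 : To = q ^ n * ((q : ℚ) - 1) * X := by linarith
      have e2 : q ^ n * Y - y = 0 :=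
        (mul_eq_zero.1 (by linarith : ((q : ℚ) - 1) * (q ^ n * Y - y) = 0)).resolve_left
          (by linarith)
      have e3 : y - D * q ^ b' = 0 :=
        (mul_eq_zero.1 (by linarith : ((q : ℚ) - 1) * (y - D * q ^ b') = 0)).resolve_left
          (by linarith)
      have e4 := (mul_eq_zero.1 (by linarith :
        D * (q ^ a' * ((q : ℚ) ^ s - 1) - q ^ (b' + 1) * (q ^ s' - 1)) = 0)).resolve_left hD.ne'
      refine ⟨by linarith, ?_, Or.inr ?_⟩
      · rw [hy, hFiR, ← mul_assoc]
        congr 1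
        linarith
      · rcases heqc (by linarith) with h0 | ⟨h0, h5⟩
        · exact Or.inl (by omega)
        · rcases Nat.eq_zero_or_pos s' with h6 | h6
          · exact Or.inl (by omega)
          · refine Or.inr ⟨by omega, by omega, by omega, ?_⟩
            rw [← h0, ← hRdef, e1, hy, mul_div_cancel_left₀ _ hN1.ne', mul_div_mul_right _ _ hR.ne']
            congr 1
            rw [eq_div_iff hN.ne']
            linarith

end Numerics

/-! ### Lower bound for the weight, with the case of equality -/

section WeightBound

variable {K V : Type*} [Field K] [AddCommGroup V] [Module K V] [FiniteDimensional K V]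
  {B : ℕ → Submodule K V} {n : ℕ}

theorem le_finrank (hB : StrictMonoOn B (Set.Iic n)) : n ≤ finrank K (B n) := by
  induction n with
  | zero => exact Nat.zero_le _
  | succ n ih =>
    have h1 := ih (hB.mono (Set.Iic_subset_Iic.2 n.le_succ))
    have h2 := Submodule.finrank_lt_finrank_of_lt (hB (by simp) (by simp) n.lt_succ_self :
      B n < B (n + 1))
    omega

variable [Finite K]

theorem ncard_sdiff_submodule {U W : Submodule K V} (h : U ≤ W) :
    (((W : Set V) \ U).ncard : ℚ) = (Nat.card K : ℚ) ^ finrank K W - (Nat.card K : ℚ) ^ finrank K U := by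
  have : Finite V := Module.finite_of_finite K
  have h1 := Set.ncard_sdiff_add_ncard_of_subset (show (U : Set V) ⊆ W from h)
  rw [ncard_submodule, ncard_submodule] at h1
  rw [eq_sub_iff_add_eq]
  exact_mod_cast h1

/-- If `φ` does not vanish on the Schubert variety and the nonzero contractions of `φ` have weight
at least `D`, then the weight of `φ` is at least `D * q ^ (dim (B (n + 1)) - (n + 1))`, with a
description of the case of equality. -/
theorem weight_bound_step (hB : StrictMonoOn B (Set.Iic (n + 1))) {φ : V [⋀^Fin (n + 1)]→ₗ[K] K}
    (hφ : (formSupport B φ).Nonempty) {D c t t' : ℕ} (hD : 0 < D)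
    (hDle : ∀ x, (formSupport B (φ.curryLeft x)).Nonempty → D ≤ (formSupport B (φ.curryLeft x)).ncard)
    (hc : finrank K (B (n + 1)) = c + n + 1)
    (ht : t + finrank K (contractionKernel B φ) = finrank K (B (n + 1)))
    (ht' : t' + finrank K ↥(contractionKernel B φ ⊓ B n) = finrank K (B n)) :
    D * Nat.card K ^ c ≤ (formSupport B φ).ncard ∧
    ((formSupport B φ).ncard = D * Nat.card K ^ c →
      (∀ x ∈ (B (n + 1) : Set V) \ contractionKernel B φ,
        (formSupport B (φ.curryLeft x)).ncard = D) ∧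
      (t = 1 ∧ t' = 0 ∨ t' = 1 ∨ t' = t ∧ 2 ≤ t ∧ finrank K (B (n + 1)) = finrank K (B n) + 1 ∧
        ((formSupport B φ).ncard : ℚ) =
          1 / ((Nat.card K : ℚ) ^ n * ((Nat.card K : ℚ) - 1)) *
              ∑ᶠ x ∈ ((B (n + 1) : Set V) \ contractionKernel B φ) \ B n,
                ((formSupport B (φ.curryLeft x)).ncard : ℚ) +
            1 / ((Nat.card K : ℚ) ^ n * ((Nat.card K : ℚ) ^ t - 1)) *
              ∑ᶠ x ∈ ((B (n + 1) : Set V) \ contractionKernel B φ) ∩ B n,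
                ((formSupport B (φ.curryLeft x)).ncard : ℚ))) := by
  classical
  have : Finite V := Module.finite_of_finite K
  have : Fintype V := Fintype.ofFinite V
  have hBn : B n < B (n + 1) := hB (by simp) (by simp) n.lt_succ_self
  set E := contractionKernel B φ with hE
  set w : V → ℕ := fun x => (formSupport B (φ.curryLeft x)).ncard with hw
  set Fo : Set V := ((B (n + 1) : Set V) \ E) \ B n with hFo
  set Fi : Set V := ((B (n + 1) : Set V) \ E) ∩ B n with hFi
  have hDw : ∀ x ∈ (B (n + 1) : Set V) \ E, D ≤ w x := by
    rintro x ⟨hx, hxE⟩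
    refine hDle x (Set.nonempty_iff_ne_empty.2 fun h0 => hxE ?_)
    exact mem_contractionKernel_iff.2 ⟨hx, h0⟩
  have hlt : E < B (n + 1) := contractionKernel_lt hB.monotoneOn hφ
  have hlt' := Submodule.finrank_lt_finrank_of_lt hlt
  have hbt := Submodule.finrank_lt_finrank_of_lt hBn
  have htt := finrank_add_finrank_le_of_le hlt.le hBn.le
  have hq : 2 ≤ Nat.card K := Finite.one_lt_card
  have hFicard : (Fi.ncard : ℚ) = (Nat.card K : ℚ) ^ finrank K (B n) -
      (Nat.card K : ℚ) ^ finrank K ↥(E ⊓ B n) := by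
    rw [← ncard_sdiff_submodule inf_le_right]
    congr 2
    ext x
    simp only [hFi, Set.mem_inter_iff, Set.mem_sdiff, SetLike.mem_coe, Submodule.mem_inf]
    have : x ∈ B n → x ∈ B (n + 1) := fun h => hBn.le h
    tauto
  have hFocard : (Fo.ncard : ℚ) = (Nat.card K : ℚ) ^ finrank K (B (n + 1)) -
      (Nat.card K : ℚ) ^ finrank K E - Fi.ncard := by
    rw [← ncard_sdiff_submodule hlt.le, eq_sub_iff_add_eq, add_comm]
    exact_mod_cast Set.ncard_inter_add_ncard_sdiff_eq_ncard _ _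
  set To : ℕ := ∑ x ∈ Fo.toFinset, w x with hTo
  set Ti : ℕ := ∑ x ∈ Fi.toFinset, w x with hTi
  have hDo : D * Fo.ncard ≤ To := by
    rw [Set.ncard_eq_toFinset_card', mul_comm, ← smul_eq_mul]
    exact Finset.card_nsmul_le_sum _ _ _ fun x hx => hDw x (Set.mem_toFinset.1 hx).1
  have hDi : D * Fi.ncard ≤ Ti := by
    rw [Set.ncard_eq_toFinset_card', mul_comm, ← smul_eq_mul]
    exact Finset.card_nsmul_le_sum _ _ _ fun x hx => hDw x (Set.mem_toFinset.1 hx).1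
  have hTo_le : To ≤ Nat.card K ^ n * (Nat.card K - 1) * {L ∈ formSupport B φ | ¬ L ≤ B n}.ncard := by
    rw [hTo, ← ncard_contractionPairs]
    refine le_trans (Set.ncard_le_ncard ?_ (Set.toFinite _)) (ncard_contractionPairs_compl_le hBn.le)
    rintro p ⟨hp, hp'⟩
    rw [Set.coe_toFinset] at hp
    exact ⟨⟨hp.1.1, hp.2⟩, hp'⟩
  have hTi_le : Ti ≤ Nat.card K ^ n * (Nat.card K ^ t' - 1) *
      {L ∈ formSupport B φ | L ≤ B n}.ncard := by
    rw [hTi, ← ncard_contractionPairs]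
    refine le_trans (Set.ncard_le_ncard ?_ (Set.toFinite _))
      (ncard_contractionPairs_le hBn.le
        (show finrank K (B n) ≤ finrank K ↥(E ⊓ B n) + t' by omega))
    rintro p ⟨hp, hp'⟩
    rw [Set.coe_toFinset] at hp
    exact ⟨hp.2, hp'⟩
  set X := {L ∈ formSupport B φ | ¬ L ≤ B n}.ncard with hX
  set Y := {L ∈ formSupport B φ | L ≤ B n}.ncard with hY
  have hXY : (formSupport B φ).ncard = X + Y := by
    have h1 := Set.ncard_inter_add_ncard_sdiff_eq_ncard (formSupport B φ) {L | L ≤ B n}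
      (Set.toFinite _)
    rw [← h1, add_comm]
    rfl
  have hTo_le' : (To : ℚ) ≤ (Nat.card K : ℚ) ^ n * ((Nat.card K : ℚ) - 1) * X := by
    have : ((Nat.card K - 1 : ℕ) : ℚ) = (Nat.card K : ℚ) - 1 := by
      rw [Nat.cast_sub (by omega), Nat.cast_one]
    rw [← this]
    exact_mod_cast hTo_le
  have hTi_le' : (Ti : ℚ) ≤ (Nat.card K : ℚ) ^ n * ((Nat.card K : ℚ) ^ t' - 1) * Y := by
    have : ((Nat.card K ^ t' - 1 : ℕ) : ℚ) = (Nat.card K : ℚ) ^ t' - 1 := by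
      rw [Nat.cast_sub (Nat.one_le_pow _ _ (by omega)), Nat.cast_one, Nat.cast_pow]
    rw [← this]
    exact_mod_cast hTi_le
  obtain ⟨hle, heq⟩ := weight_bound_numerics (D := (D : ℚ)) hq hc ht.symm ht'.symm hbt (by omega)
    (by omega) (by exact_mod_cast hD) (Nat.cast_nonneg Y) hFicard hFocard hTo_le' hTi_le'
    (by exact_mod_cast hDo) (by exact_mod_cast hDi)
  refine ⟨by rw [hXY]; exact_mod_cast hle, fun h => ?_⟩
  obtain ⟨h1, h2, h3⟩ := heq (by rw [hXY] at h; exact_mod_cast h)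
  -- A sum whose terms are all at least `D` and whose average is `D` has every term equal to `D`.
  have hall : ∀ (S : Set V) [Fintype S], S ⊆ (B (n + 1) : Set V) \ E →
      ((∑ x ∈ S.toFinset, w x : ℕ) : ℚ) = D * S.ncard → ∀ x ∈ S, w x = D := by
    intro S _ hS hsum x hx
    have h4 : ∑ x ∈ S.toFinset, D = ∑ x ∈ S.toFinset, w x := by
      rw [Finset.sum_const, smul_eq_mul, mul_comm, ← Set.ncard_eq_toFinset_card']
      exact_mod_cast hsum.symm
    exact ((Finset.sum_eq_sum_iff_of_le fun y hy => hDw y (hS (Set.mem_toFinset.1 hy))).1 h4 x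
      (Set.mem_toFinset.2 hx)).symm
  refine ⟨fun x hx => ?_, h3.imp id (Or.imp id ?_)⟩
  · by_cases hxB : x ∈ B n
    · exact hall Fi Set.inter_subset_left h2 x ⟨hx, hxB⟩
    · exact hall Fo Set.sdiff_subset h1 x ⟨hx, hxB⟩
  · rintro ⟨h4, h5, h6, h7⟩
    refine ⟨h4, h5, h6, ?_⟩
    rw [finsum_mem_eq_toFinset_sum, finsum_mem_eq_toFinset_sum, hXY]
    rw [hTo, hTi] at h7
    push_cast at h7 ⊢
    rw [h7]
    ring

theorem pow_le_ncard_formSupport (hB : StrictMonoOn B (Set.Iic n)) {φ : V [⋀^Fin n]→ₗ[K] K}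
    (hφ : (formSupport B φ).Nonempty) :
    Nat.card K ^ (∑ i ∈ Finset.Icc 1 n, (finrank K (B i) - i)) ≤ (formSupport B φ).ncard := by
  have : Finite V := Module.finite_of_finite K
  induction n with
  | zero => simpa [Nat.one_le_iff_ne_zero, Set.ncard_eq_zero (Set.toFinite _)] using hφ.ne_empty
  | succ n ih =>
    have h1 := le_finrank hB
    rw [Finset.sum_Icc_succ_top (by omega), pow_add]
    have hlt := contractionKernel_lt hB.monotoneOn hφ
    exact (weight_bound_step hB hφ (pow_pos Nat.card_pos _)
      (fun x hx => ih (hB.mono (Set.Iic_subset_Iic.2 n.le_succ)) hx) (by omega)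
      (Nat.sub_add_cancel (Submodule.finrank_mono hlt.le))
      (Nat.sub_add_cancel (Submodule.finrank_mono inf_le_right))).1

end WeightBound

/-! ### A subspace transversal to the flag, and the points disjoint from it -/

section Transversal

variable {K V : Type*} [Field K] [AddCommGroup V] [Module K V]

/-- Enlarging `U ≤ P` by a space independent of `P` does not change the intersections with the
subspaces of `P`. -/
theorem sup_inf_eq_of_le {U C P R : Submodule K V} (hU : U ≤ P) (hC : C ⊓ P = ⊥) (hR : R ≤ P) :
    (U ⊔ C) ⊓ R = U ⊓ R := by
  rw [← inf_eq_right.2 hR, ← inf_assoc, sup_inf_assoc_of_le C hU, hC, sup_bot_eq, ← inf_assoc,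
    inf_eq_left.2 hU]

variable [FiniteDimensional K V] {B : ℕ → Submodule K V} {n : ℕ}

theorem exists_complement_in {P Q : Submodule K V} (h : P ≤ Q) :
    ∃ C ≤ Q, C ⊓ P = ⊥ ∧ finrank K C + finrank K P = finrank K Q := by
  obtain ⟨C, hC⟩ := Submodule.exists_isCompl P
  have hinf : C ⊓ Q ⊓ P = ⊥ := by
    rw [inf_assoc, inf_eq_right.2 h, inf_comm, hC.inf_eq_bot]
  refine ⟨C ⊓ Q, inf_le_right, hinf, ?_⟩
  rw [← Submodule.finrank_sup_add_finrank_inf_eq, hinf, finrank_bot, add_zero, sup_comm,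
    ← sup_inf_assoc_of_le C h, hC.sup_eq_top, top_inf_eq]

theorem finrank_sup_of_inf_eq_bot {U C P : Submodule K V} (hU : U ≤ P) (hC : C ⊓ P = ⊥) :
    finrank K ↥(U ⊔ C) = finrank K U + finrank K C := by
  rw [← Submodule.finrank_sup_add_finrank_inf_eq U C,
    (eq_bot_iff.2 (hC ▸ (inf_comm U C).trans_le (inf_le_inf_left C hU)) : U ⊓ C = ⊥), finrank_bot,
    add_zero]

/-- At each step of the flag, adjoin to `U` a complement in `B (n + 1)` of `B n` enlarged by one
vector: the codimension grows by one and the earlier intersections do not change. -/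
theorem exists_le_transversal (hB : StrictMonoOn B (Set.Iic n)) :
    ∃ U ≤ B n, ∀ i ≤ n, finrank K ↥(U ⊓ B i) + i = finrank K (B i) := by
  induction n with
  | zero =>
    refine ⟨B 0, le_rfl, fun i hi => ?_⟩
    obtain rfl : i = 0 := Nat.le_zero.1 hi
    rw [inf_idem, add_zero]
  | succ n ih =>
    obtain ⟨U, hU, hUi⟩ := ih (hB.mono (Set.Iic_subset_Iic.2 n.le_succ))
    have hlt : B n < B (n + 1) := hB (by simp) (by simp) n.lt_succ_self
    obtain ⟨x, hx, hxn⟩ := SetLike.exists_of_lt hlt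
    obtain ⟨C, hCle, hC, hfin⟩ := exists_complement_in (sup_span_singleton_le hlt.le hx)
    rw [finrank_sup_span_singleton hxn] at hfin
    have hC' : C ⊓ B n = ⊥ := eq_bot_iff.2 (hC ▸ inf_le_inf_left C le_sup_left)
    have hle : U ⊔ C ≤ B (n + 1) := sup_le (hU.trans hlt.le) hCle
    refine ⟨U ⊔ C, hle, fun i hi => ?_⟩
    rcases Nat.lt_or_ge n i with h | h
    · obtain rfl : i = n + 1 := by omega
      have h1 := hUi n le_rfl
      rw [inf_eq_left.2 hU] at h1
      rw [inf_eq_left.2 hle, finrank_sup_of_inf_eq_bot hU hC']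
      omega
    · have hBi : B i ≤ B n :=
        hB.monotoneOn (Set.mem_Iic.2 (by omega)) (Set.mem_Iic.2 (by omega)) h
      rw [sup_inf_eq_of_le hU hC' hBi, hUi i h]

theorem exists_transversal (hB : StrictMonoOn B (Set.Iic n)) :
    ∃ U : Submodule K V, finrank K U + n = finrank K V ∧
      ∀ i ≤ n, finrank K ↥(U ⊓ B i) + i = finrank K (B i) := by
  obtain ⟨U, hU, hUi⟩ := exists_le_transversal hB
  obtain ⟨C, -, hC, hfin⟩ := exists_complement_in (le_top : B n ≤ ⊤)
  refine ⟨U ⊔ C, ?_, fun i hi => ?_⟩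
  · have h1 := hUi n le_rfl
    rw [inf_eq_left.2 hU] at h1
    rw [finrank_top] at hfin
    rw [finrank_sup_of_inf_eq_bot hU hC]
    omega
  · have hBi : B i ≤ B n := hB.monotoneOn (Set.mem_Iic.2 (by omega)) (Set.mem_Iic.2 le_rfl) hi
    rw [sup_inf_eq_of_le hU hC hBi, hUi i hi]

/-- A vector of `B (n + 1)` off `B n` and the transversal. -/
theorem exists_notMem_sup_transversal {U L : Submodule K V}
    (hUi : finrank K ↥(U ⊓ B (n + 1)) + (n + 1) = finrank K (B (n + 1)))
    (hL : finrank K L = n) :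
    ∃ x ∈ B (n + 1), x ∉ L ⊔ U ⊓ B (n + 1) := by
  by_contra! h
  have h1 := Submodule.finrank_mono (show B (n + 1) ≤ L ⊔ U ⊓ B (n + 1) from h)
  have h2 := Submodule.finrank_sup_add_finrank_inf_eq L (U ⊓ B (n + 1))
  omega

theorem exists_mem_schubertSet_inf_eq_bot (hB : StrictMonoOn B (Set.Iic n)) {U : Submodule K V}
    (hUi : ∀ i ≤ n, finrank K ↥(U ⊓ B i) + i = finrank K (B i)) :
    ∃ L ∈ schubertSet B n, L ⊓ U = ⊥ := by
  induction n with
  | zero => exact ⟨⊥, ⟨finrank_bot K V, by simp⟩, bot_inf_eq U⟩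
  | succ n ih =>
    obtain ⟨L, hL, hLU⟩ := ih (hB.mono (Set.Iic_subset_Iic.2 n.le_succ))
      fun i hi => hUi i (hi.trans n.le_succ)
    have hle : B n ≤ B (n + 1) := hB.monotoneOn (by simp) (by simp) n.le_succ
    obtain ⟨x, hxB, hx⟩ := exists_notMem_sup_transversal (hUi (n + 1) le_rfl) hL.1
    have hxL : x ∉ L := fun h => hx (Submodule.mem_sup_left h)
    have hmem := sup_span_singleton_mem_schubertSet hle hL hxB hxL
    refine ⟨_, hmem, eq_bot_iff.2 ?_⟩
    rintro y ⟨hy, hyU⟩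
    have hyB := le_of_mem_schubertSet hmem hy
    obtain ⟨l, hl, z, hz, rfl⟩ := Submodule.mem_sup.1 hy
    obtain ⟨a, rfl⟩ := Submodule.mem_span_singleton.1 hz
    have ha : a = 0 := by
      by_contra ha
      refine hx ((Submodule.smul_mem_iff _ ha).1 ?_)
      rw [← Submodule.add_mem_iff_right _ (Submodule.mem_sup_left hl)]
      exact Submodule.mem_sup_right ⟨hyU, hyB⟩
    subst ha
    rw [zero_smul, add_zero] at hyU ⊢
    exact hLU ▸ ⟨hl, hyU⟩

/-- Inside `B n`, the space `L ⊓ B n` is independent of `U ⊓ B n`, which has codimension `n`; so its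
dimension, at least `n` by the Schubert condition, is exactly `n`. -/
theorem inf_mem_schubertSet_of_inf_eq_bot (hB : StrictMonoOn B (Set.Iic (n + 1)))
    {U L : Submodule K V} (hUi : finrank K ↥(U ⊓ B n) + n = finrank K (B n))
    (hL : L ∈ schubertSet B (n + 1)) (hLU : L ⊓ U = ⊥) : L ⊓ B n ∈ schubertSet B n := by
  have h1 := finrank_add_finrank_le_of_le (inf_le_right : L ⊓ B n ≤ B n)
    (inf_le_right : U ⊓ B n ≤ B n)
  have h2 : L ⊓ B n ⊓ (U ⊓ B n) = ⊥ :=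
    eq_bot_iff.2 (hLU ▸ inf_le_inf inf_le_left inf_le_left)
  rw [h2, finrank_bot] at h1
  refine ⟨le_antisymm (by omega) (hL.2 n n.le_succ), fun i hi => ?_⟩
  have hBi : B i ≤ B n :=
    hB.monotoneOn (Set.mem_Iic.2 (by omega)) (Set.mem_Iic.2 (by omega)) hi
  rw [inf_assoc, inf_eq_right.2 hBi]
  exact hL.2 i (by omega)

/-- Fix a vector `x` of `B (n + 1)` off `L' + U ⊓ B (n + 1)` for each `L'`. As `L` and `U ⊓ B (n +
1)` span `B (n + 1)`, some translate `x + u` with `u ∈ U ⊓ B (n + 1)` lies in `L`, so `L` is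
recovered from `L ⊓ B n` and `u`. -/
theorem ncard_schubertSet_inf_eq_bot_le [Finite K] (hB : StrictMonoOn B (Set.Iic n))
    {U : Submodule K V} (hUi : ∀ i ≤ n, finrank K ↥(U ⊓ B i) + i = finrank K (B i)) :
    {L ∈ schubertSet B n | L ⊓ U = ⊥}.ncard ≤
      Nat.card K ^ (∑ i ∈ Finset.Icc 1 n, (finrank K (B i) - i)) := by
  have : Finite V := Module.finite_of_finite K
  induction n with
  | zero =>
    rw [Finset.Icc_eq_empty (by omega), Finset.sum_empty, pow_zero, Set.ncard_le_one]
    rintro L ⟨hL, -⟩ M ⟨hM, -⟩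
    rw [Submodule.finrank_eq_zero.1 hL.1, Submodule.finrank_eq_zero.1 hM.1]
  | succ n ih =>
    have ih' := ih (hB.mono (Set.Iic_subset_Iic.2 n.le_succ))
      fun i hi => hUi i (hi.trans n.le_succ)
    have hU1 := hUi (n + 1) le_rfl
    have hUcard : ((U ⊓ B (n + 1) : Submodule K V) : Set V).ncard =
        Nat.card K ^ (finrank K (B (n + 1)) - (n + 1)) := by
      rw [ncard_submodule, ← hU1, Nat.add_sub_cancel]
    have hchoose : ∀ L' : Submodule K V, ∃ x, finrank K L' = n →
        x ∈ B (n + 1) ∧ x ∉ L' ⊔ U ⊓ B (n + 1) := by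
      intro L'
      by_cases h : finrank K L' = n
      · obtain ⟨x, hx⟩ := exists_notMem_sup_transversal hU1 h
        exact ⟨x, fun _ => hx⟩
      · exact ⟨0, fun h' => absurd h' h⟩
    choose x hx using hchoose
    rw [Finset.sum_Icc_succ_top (by omega), pow_add, ← hUcard]
    refine le_trans ?_ (Nat.mul_le_mul_right _ ih')
    rw [← Set.ncard_prod]
    refine le_trans (Set.ncard_le_ncard ?_ ((Set.toFinite _).image _))
      (Set.ncard_image_le (f := fun p => p.1 ⊔ K ∙ (x p.1 + p.2)) (Set.toFinite _))
    rintro L ⟨hL, hLU⟩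
    have hL' := inf_mem_schubertSet_of_inf_eq_bot hB (hUi n n.le_succ) hL hLU
    obtain ⟨hxB, hxL⟩ := hx _ hL'.1
    have hLB := le_of_mem_schubertSet hL
    have htop : B (n + 1) ≤ L ⊔ U ⊓ B (n + 1) := by
      refine (Submodule.eq_of_le_of_finrank_le (sup_le hLB inf_le_right) ?_).ge
      have h1 := Submodule.finrank_sup_add_finrank_inf_eq L (U ⊓ B (n + 1))
      have h2 : L ⊓ (U ⊓ B (n + 1)) = ⊥ := eq_bot_iff.2 (hLU ▸ inf_le_inf_left L inf_le_left)
      rw [h2, finrank_bot, hL.1] at h1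
      omega
    obtain ⟨l, hl, u, hu, hlu⟩ := Submodule.mem_sup.1 (htop hxB)
    have hleq : x (L ⊓ B n) + -u = l := by rw [← hlu, add_neg_cancel_right]
    refine ⟨(L ⊓ B n, -u), ⟨⟨hL', eq_bot_iff.2 (hLU ▸ inf_le_inf_right U inf_le_left)⟩,
      neg_mem hu⟩, ?_⟩
    simp only [hleq]
    refine sup_span_singleton_eq hL.1 hL'.1 inf_le_left hl fun h => hxL ?_
    rw [← hlu]
    exact add_mem (Submodule.mem_sup_left h) (Submodule.mem_sup_right hu)

end Transversal

/-! ### Multivectors as alternating forms -/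

section WedgeForm

variable {K V : Type*} [Field K] [AddCommGroup V] [Module K V]

/-- The alternating form `v ↦ f ∧ v_1 ∧ ⋯ ∧ v_b` of `f ∈ ⋀^a V`, where `vol` identifies `⋀^m V`
with `K` for `m = a + b`. -/
noncomputable def wedgeForm {a b m : ℕ} (h : a + b = m) (vol : ⋀[K]^m V ≃ₗ[K] K)
    (f : ⋀[K]^a V) : V [⋀^Fin b]→ₗ[K] K :=
  (vol.toLinearMap ∘ₗ wedge h f).compAlternatingMap (exteriorPower.ιMulti K b)

theorem wedgeForm_apply {a b m : ℕ} (h : a + b = m) (vol : ⋀[K]^m V ≃ₗ[K] K) (f : ⋀[K]^a V)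
    (v : Fin b → V) : wedgeForm h vol f v = vol (wedge h f (exteriorPower.ιMulti K b v)) :=
  rfl

theorem coe_wedge {a b c : ℕ} (h : a + b = c) (f : ⋀[K]^a V) (g : ⋀[K]^b V) :
    (wedge h f g : ExteriorAlgebra K V) = f * g :=
  rfl

theorem coe_wedgeVec {a c : ℕ} (h : a + 1 = c) (f : ⋀[K]^a V) (x : V) :
    (wedgeVec h f x : ExteriorAlgebra K V) = f * ExteriorAlgebra.ι K x := by
  have : wedgeVec h f x = wedge h f ((exteriorPower.oneEquiv K V).symm x) := rfl
  rw [this, coe_wedge, exteriorPower.oneEquiv_symm_apply, exteriorPower.ιMulti_apply_coe,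
    ExteriorAlgebra.ιMulti_apply]
  simp

/-- Associativity of the exterior product: `x` becomes the first argument of the form. -/
theorem wedgeForm_wedgeVec {a b c m : ℕ} (h : a + (b + 1) = m) (hac : a + 1 = c) (hc : c + b = m)
    (vol : ⋀[K]^m V ≃ₗ[K] K) (f : ⋀[K]^a V) (x : V) :
    wedgeForm hc vol (wedgeVec hac f x) = (wedgeForm h vol f).curryLeft x := by
  ext v
  rw [AlternatingMap.curryLeft_apply_apply, wedgeForm_apply, wedgeForm_apply]
  congr 1
  apply Subtype.ext
  rw [coe_wedge, coe_wedge, coe_wedgeVec, exteriorPower.ιMulti_apply_coe,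
    exteriorPower.ιMulti_apply_coe, ExteriorAlgebra.ιMulti_succ_apply, mul_assoc]
  rfl

theorem wedge_ιMulti {a b : ℕ} (u : Fin a → V) (v : Fin b → V) :
    wedge rfl (exteriorPower.ιMulti K a u) (exteriorPower.ιMulti K b v) =
      exteriorPower.ιMulti K (a + b) (Fin.append u v) := by
  apply Subtype.ext
  rw [coe_wedge, exteriorPower.ιMulti_apply_coe, exteriorPower.ιMulti_apply_coe,
    exteriorPower.ιMulti_apply_coe, ExteriorAlgebra.ιMulti_apply, ExteriorAlgebra.ιMulti_apply,
    ExteriorAlgebra.ιMulti_apply, ← List.prod_append, ← List.ofFn_fin_append]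
  congr 2
  ext i
  refine Fin.addCases (fun j => ?_) (fun j => ?_) i <;> simp

theorem ιMulti_ne_zero_iff [FiniteDimensional K V] {m : ℕ} (hm : finrank K V = m) (v : Fin m → V) :
    exteriorPower.ιMulti K m v ≠ 0 ↔ LinearIndependent K v := by
  constructor
  · intro h
    by_contra hv
    refine h (Subtype.ext ?_)
    rw [exteriorPower.ιMulti_apply_coe]
    exact AlternatingMap.map_linearDependent _ _ hv
  · intro hv h
    let b : Basis (Fin m) K V := basisOfLinearIndependentOfCardEqFinrank' v hv (by simp [hm])
    have h1 := exteriorPower.alternatingMapLinearEquiv_apply_ιMulti b.det v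
    have h2 : b.det v = 1 := by
      have hb : ⇑b = v := by simp [b]
      rw [← b.det_self, hb]
    rw [h, map_zero, h2] at h1
    exact zero_ne_one h1

theorem linearIndependent_append_iff {a b : ℕ} {u : Fin a → V} {v : Fin b → V} :
    LinearIndependent K (Fin.append u v) ↔ LinearIndependent K u ∧ LinearIndependent K v ∧
      Disjoint (Submodule.span K (Set.range u)) (Submodule.span K (Set.range v)) := by
  rw [← linearIndependent_equiv finSumFinEquiv, linearIndependent_sum]
  have h1 : (Fin.append u v ∘ finSumFinEquiv) ∘ Sum.inl = u := by ext i; simp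
  have h2 : (Fin.append u v ∘ finSumFinEquiv) ∘ Sum.inr = v := by ext i; simp
  rw [h1, h2]

/-- The product is a top-degree wedge of the concatenated families, nonzero exactly when they form a
basis of `V`. -/
theorem wedgeForm_ιMulti_ne_zero_iff [FiniteDimensional K V] {a b m : ℕ} (h : a + b = m)
    (hm : finrank K V = m) (vol : ⋀[K]^m V ≃ₗ[K] K) {u : Fin a → V} (hu : LinearIndependent K u)
    (v : Fin b → V) :
    wedgeForm h vol (exteriorPower.ιMulti K a u) v ≠ 0 ↔ LinearIndependent K v ∧
      Disjoint (Submodule.span K (Set.range u)) (Submodule.span K (Set.range v)) := by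
  subst h
  rw [wedgeForm_apply, wedge_ιMulti, (map_ne_zero_iff vol vol.injective),
    ιMulti_ne_zero_iff hm, linearIndependent_append_iff]
  simp [hu]

end WedgeForm

/-! ### Schubert codes: minimum distance and minimum weight codewords -/

section Code

variable {K V : Type*} [Field K] [AddCommGroup V] [Module K V]
  {A : ℕ → Submodule K V} {ℓ m : ℕ}

theorem mem_schubertSet_update_iff {L : Submodule K V} :
    L ∈ schubertSet (Function.update A 0 ⊥) ℓ ↔
      finrank K L = ℓ ∧ ∀ i ∈ Set.Icc 1 ℓ, i ≤ finrank K ↥(L ⊓ A i) := by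
  refine and_congr_right fun _ => ⟨fun h i hi => ?_, fun h i hi => ?_⟩
  · have := h i hi.2
    rwa [Function.update_of_ne (by have := hi.1; omega)] at this
  · rcases Nat.eq_zero_or_pos i with rfl | h0
    · exact Nat.zero_le _
    · rw [Function.update_of_ne h0.ne']
      exact h i ⟨h0, hi⟩

/-- The flag constrains only the indices from `1` on; setting the value at `0` to `⊥` lets the
inductions start from the empty flag, and strictness at the first step is that `A 1` is nonzero. -/
theorem IsPartialFlag.strictMonoOn_update (hA : IsPartialFlag A ℓ) :
    StrictMonoOn (Function.update A 0 ⊥) (Set.Iic ℓ) := by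
  intro i hi j hj hij
  rw [Set.mem_Iic] at hi hj
  rw [Function.update_of_ne (show j ≠ 0 by omega)]
  rcases Nat.eq_zero_or_pos i with rfl | h0
  · rw [Function.update_self]
    exact bot_lt_iff_ne_bot.2 (hA.ne_bot j ⟨hij, hj⟩)
  · rw [Function.update_of_ne h0.ne']
    exact hA.strictMonoOn ⟨h0, hi⟩ ⟨h0.trans_le hij.le, hj⟩ hij

theorem IsPartialFlag.mono (hA : IsPartialFlag A ℓ) {k : ℕ} (hk : k ≤ ℓ) : IsPartialFlag A k where
  strictMonoOn := hA.strictMonoOn.mono (Set.Icc_subset_Icc_right hk)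
  ne_bot i hi := hA.ne_bot i (Set.Icc_subset_Icc_right hk hi)

variable [FiniteDimensional K V]

theorem evalMap_ne_zero_iff (h : ℓ ≤ m) (vol : ⋀[K]^m V ≃ₗ[K] K)
    {P : SchubertVariety A ℓ → ⋀[K]^ℓ V} (hP : IsPlueckerChoice P) (f : ⋀[K]^(m - ℓ) V)
    (L : SchubertVariety A ℓ) :
    evalMap h vol P f L ≠ 0 ↔
      L.1 ∈ formSupport (Function.update A 0 ⊥) (wedgeForm (Nat.sub_add_cancel h) vol f) := by
  obtain ⟨v, hv, hspan, hPv⟩ := hP L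
  have heval : evalMap h vol P f L = wedgeForm (Nat.sub_add_cancel h) vol f v := by
    rw [wedgeForm_apply, ← hPv]
    rfl
  have hvL : ∀ i, v i ∈ L.1 := fun i => hspan ▸ Submodule.subset_span ⟨i, rfl⟩
  rw [heval]
  constructor
  · intro hne
    exact ⟨mem_schubertSet_update_iff.2 L.2, v, hvL, hne⟩
  · rintro ⟨-, w, hw, hne⟩
    exact apply_ne_zero_of_linearIndependent L.2.1 hw hne hvL hv

theorem evalMap_eq_zero_iff (h : ℓ ≤ m) (vol : ⋀[K]^m V ≃ₗ[K] K)
    {P : SchubertVariety A ℓ → ⋀[K]^ℓ V} (hP : IsPlueckerChoice P) (f : ⋀[K]^(m - ℓ) V) :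
    evalMap h vol P f = 0 ↔
      formSupport (Function.update A 0 ⊥) (wedgeForm (Nat.sub_add_cancel h) vol f) = ∅ := by
  rw [Set.eq_empty_iff_forall_notMem, funext_iff]
  constructor
  · intro h0 L hL
    exact (evalMap_ne_zero_iff h vol hP f ⟨L, mem_schubertSet_update_iff.1 hL.1⟩).2 hL (h0 _)
  · intro h0 L
    by_contra hne
    exact h0 L.1 ((evalMap_ne_zero_iff h vol hP f L).1 hne)

variable [Finite K] [DecidableEq K]

theorem hammingNorm_evalMap (h : ℓ ≤ m) (vol : ⋀[K]^m V ≃ₗ[K] K)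
    {P : SchubertVariety A ℓ → ⋀[K]^ℓ V} (hP : IsPlueckerChoice P) (f : ⋀[K]^(m - ℓ) V) :
    hammingNorm (evalMap h vol P f) =
      (formSupport (Function.update A 0 ⊥) (wedgeForm (Nat.sub_add_cancel h) vol f)).ncard := by
  classical
  have hinj : Function.Injective fun L : SchubertVariety A ℓ => L.1 := fun _ _ h => Subtype.ext h
  have himage : formSupport (Function.update A 0 ⊥) (wedgeForm (Nat.sub_add_cancel h) vol f) =
      (fun L : SchubertVariety A ℓ => L.1) '' {L : SchubertVariety A ℓ | evalMap h vol P f L ≠ 0} := by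
    ext L
    constructor
    · intro hL
      exact ⟨⟨L, mem_schubertSet_update_iff.1 hL.1⟩, (evalMap_ne_zero_iff h vol hP f _).2 hL, rfl⟩
    · rintro ⟨L, hL, rfl⟩
      exact (evalMap_ne_zero_iff h vol hP f L).1 hL
  rw [himage, Set.ncard_image_of_injective _ hinj, Set.ncard_eq_toFinset_card']
  unfold hammingNorm
  congr 1
  ext L
  simp

theorem pow_le_hammingNorm_evalMap (hA : IsPartialFlag A ℓ) (h : ℓ ≤ m) (vol : ⋀[K]^m V ≃ₗ[K] K)
    {P : SchubertVariety A ℓ → ⋀[K]^ℓ V} (hP : IsPlueckerChoice P) {f : ⋀[K]^(m - ℓ) V}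
    (hf : evalMap h vol P f ≠ 0) :
    Nat.card K ^ (∑ i ∈ Finset.Icc 1 ℓ, (finrank K (Function.update A 0 ⊥ i) - i)) ≤
      hammingNorm (evalMap h vol P f) := by
  rw [hammingNorm_evalMap h vol hP]
  refine pow_le_ncard_formSupport hA.strictMonoOn_update (Set.nonempty_iff_ne_empty.2 ?_)
  rwa [Ne, ← evalMap_eq_zero_iff h vol hP]

/-- The witness is the wedge of a basis of a transversal `U`, whose support is the set of Schubert
points meeting `U` trivially. -/
theorem exists_hammingNorm_evalMap_le (hA : IsPartialFlag A ℓ) (h : ℓ ≤ m)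
    (hm : finrank K V = m) (vol : ⋀[K]^m V ≃ₗ[K] K) {P : SchubertVariety A ℓ → ⋀[K]^ℓ V}
    (hP : IsPlueckerChoice P) :
    ∃ f : ⋀[K]^(m - ℓ) V, evalMap h vol P f ≠ 0 ∧ hammingNorm (evalMap h vol P f) ≤
      Nat.card K ^ (∑ i ∈ Finset.Icc 1 ℓ, (finrank K (Function.update A 0 ⊥ i) - i)) := by
  have : Finite V := Module.finite_of_finite K
  have hB := hA.strictMonoOn_update
  obtain ⟨U, hU, hUi⟩ := exists_transversal hB
  let u := finBasisOfFinrankEq K U (show finrank K U = m - ℓ by omega)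
  have hu : LinearIndependent K fun i => (u i : V) :=
    u.linearIndependent.map' U.subtype (Submodule.ker_subtype U)
  have hspan : Submodule.span K (Set.range fun i => (u i : V)) = U :=
    Submodule.eq_of_le_of_finrank_le
      (Submodule.span_le.2 (Set.range_subset_iff.2 fun i => (u i).2))
      (by rw [finrank_span_eq_card hu, Fintype.card_fin]; omega)
  have hsupp : formSupport (Function.update A 0 ⊥) (wedgeForm (Nat.sub_add_cancel h) vol
      (exteriorPower.ιMulti K (m - ℓ) fun i => (u i : V))) =
      {L ∈ schubertSet (Function.update A 0 ⊥) ℓ | L ⊓ U = ⊥} := by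
    ext L
    refine and_congr_right fun hL => ?_
    simp only [wedgeForm_ιMulti_ne_zero_iff _ hm vol hu, hspan]
    constructor
    · rintro ⟨v, hv, hli, hdisj⟩
      have hvL : Submodule.span K (Set.range v) = L :=
        Submodule.eq_of_le_of_finrank_le (Submodule.span_le.2 (Set.range_subset_iff.2 hv))
          (by rw [finrank_span_eq_card hli, hL.1, Fintype.card_fin])
      rw [hvL] at hdisj
      exact disjoint_iff.1 hdisj.symm
    · intro hLU
      let v := finBasisOfFinrankEq K L hL.1
      refine ⟨fun i => v i, fun i => (v i).2,
        v.linearIndependent.map' L.subtype (Submodule.ker_subtype L), ?_⟩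
      exact (disjoint_iff.2 hLU).symm.mono_right
        (Submodule.span_le.2 (Set.range_subset_iff.2 fun i => (v i).2))
  refine ⟨exteriorPower.ιMulti K (m - ℓ) fun i => (u i : V), ?_, ?_⟩
  · rw [Ne, evalMap_eq_zero_iff h vol hP, hsupp, ← Ne, ← Set.nonempty_iff_ne_empty]
    exact exists_mem_schubertSet_inf_eq_bot hB hUi
  · rw [hammingNorm_evalMap h vol hP, hsupp]
    exact ncard_schubertSet_inf_eq_bot_le hB hUi

/-- The minimum distance of the Schubert code. -/
theorem minDist_schubertCode (hA : IsPartialFlag A ℓ) (h : ℓ ≤ m)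
    (hm : finrank K V = m) (vol : ⋀[K]^m V ≃ₗ[K] K) {P : SchubertVariety A ℓ → ⋀[K]^ℓ V}
    (hP : IsPlueckerChoice P) :
    minDist (schubertCode h vol P) =
      Nat.card K ^ (∑ i ∈ Finset.Icc 1 ℓ, (finrank K (Function.update A 0 ⊥ i) - i)) := by
  obtain ⟨f, hf, hle⟩ := exists_hammingNorm_evalMap_le hA h hm vol hP
  have hmem : hammingNorm (evalMap h vol P f) ∈
      {w : ℕ | ∃ c ∈ schubertCode h vol P, c ≠ 0 ∧ hammingNorm c = w} :=
    ⟨_, LinearMap.mem_range_self _ f, hf, rfl⟩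
  refine le_antisymm ((Nat.sInf_le hmem).trans hle) ?_
  obtain ⟨_, ⟨g, rfl⟩, hg, hw⟩ := Nat.sInf_mem ⟨_, hmem⟩
  rw [minDist, ← hw]
  exact pow_le_hammingNorm_evalMap hA h vol hP hg

/-- The minimum weight codewords of a Schubert code in terms of the Schubert code of the flag
without its last member. -/
theorem contraction_of_isMinWeightCodeword {n : ℕ} (hn : 0 < n) (hA : IsPartialFlag A (n + 1))
    (h : n + 1 ≤ m) (h' : n ≤ m) (hm : finrank K V = m) (vol : ⋀[K]^m V ≃ₗ[K] K)
    {P : SchubertVariety A (n + 1) → ⋀[K]^(n + 1) V} (hP : IsPlueckerChoice P)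
    {P' : SchubertVariety A n → ⋀[K]^n V} (hP' : IsPlueckerChoice P')
    (hmn : m - (n + 1) + 1 = m - n) {f : ⋀[K]^(m - (n + 1)) V}
    (hf : IsMinWeightCodeword (schubertCode h vol P) (evalMap h vol P f))
    {c : V →ₗ[K] (SchubertVariety A n → K)} (hc : c = evalMap h' vol P' ∘ₗ wedgeVec hmn f)
    {E : Submodule K V} (hE : E = A (n + 1) ⊓ LinearMap.ker c) {t t' : ℕ}
    (ht : t = codimIn (A (n + 1)) E) (ht' : t' = codimIn (A n) (E ⊓ A n)) :
    (∀ x ∈ (A (n + 1) : Set V) \ E, IsMinWeightCodeword (schubertCode h' vol P') (c x)) ∧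
    (t = 1 ∧ t' = 0 ∨ t' = t ∧ 2 ≤ t ∧ finrank K (A (n + 1)) = finrank K (A n) + 1 ∧
      (hammingNorm (evalMap h vol P f) : ℚ) =
        1 / ((Nat.card K : ℚ) ^ n * ((Nat.card K : ℚ) - 1)) *
            ∑ᶠ x ∈ ((A (n + 1) : Set V) \ E) \ A n, (hammingNorm (c x) : ℚ) +
          1 / ((Nat.card K : ℚ) ^ n * ((Nat.card K : ℚ) ^ t - 1)) *
            ∑ᶠ x ∈ ((A (n + 1) : Set V) \ E) ∩ A n, (hammingNorm (c x) : ℚ)) := by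
  have hA' := hA.mono n.le_succ
  set B := Function.update A 0 ⊥ with hBdef
  have hB : StrictMonoOn B (Set.Iic (n + 1)) := hA.strictMonoOn_update
  have hB1 : B (n + 1) = A (n + 1) := Function.update_of_ne (by omega) _ _
  have hB0 : B n = A n := Function.update_of_ne (by omega) _ _
  set φ := wedgeForm (Nat.sub_add_cancel h) vol f with hφ
  have hcx : ∀ x, c x = evalMap h' vol P' (wedgeVec hmn f x) := fun x => by rw [hc]; rfl
  have hcurry : ∀ x, wedgeForm (Nat.sub_add_cancel h') vol (wedgeVec hmn f x) = φ.curryLeft x :=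
    fun x => wedgeForm_wedgeVec _ _ _ vol f x
  have hc0 : ∀ x, c x = 0 ↔ formSupport B (φ.curryLeft x) = ∅ := fun x => by
    rw [hcx, evalMap_eq_zero_iff h' vol hP', hcurry]
  have hcw : ∀ x, hammingNorm (c x) = (formSupport B (φ.curryLeft x)).ncard := fun x => by
    rw [hcx, hammingNorm_evalMap h' vol hP', hcurry]
  have hEker : contractionKernel B φ = E := by
    ext x
    rw [mem_contractionKernel_iff, hE, hB1, ← hc0]
    rfl
  have hw := hammingNorm_evalMap h vol hP f
  obtain ⟨-, hf0, hfmin⟩ := hf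
  rw [minDist_schubertCode hA h hm vol hP, Finset.sum_Icc_succ_top (by omega), pow_add, hw] at hfmin
  have hne : (formSupport B φ).Nonempty := by
    rwa [Set.nonempty_iff_ne_empty, Ne, ← evalMap_eq_zero_iff h vol hP]
  have hle1 : E ≤ A (n + 1) := hE ▸ inf_le_left
  have hfr := le_finrank hB
  obtain ⟨-, heq⟩ := weight_bound_step (t := t) (t' := t') (c := finrank K (B (n + 1)) - (n + 1))
    hB hne (pow_pos Nat.card_pos (∑ i ∈ Finset.Icc 1 n, (finrank K (B i) - i)))
    (fun x hx => pow_le_ncard_formSupport (hB.mono (Set.Iic_subset_Iic.2 n.le_succ)) hx)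
    (by omega) (by rw [hEker, hB1, ht, codimIn_add_finrank hle1])
    (by rw [hEker, hB0, ht', codimIn_add_finrank inf_le_right])
  obtain ⟨hmin, hcases⟩ := heq hfmin
  rw [hEker, hB1] at hmin
  refine ⟨fun x hx => ⟨?_, ?_, ?_⟩, ?_⟩
  · rw [hcx]
    exact LinearMap.mem_range_self _ _
  · intro h0
    exact hx.2 (hE ▸ ⟨hx.1, h0⟩)
  · rw [minDist_schubertCode hA' h' hm vol hP', hcw, hmin x hx]
  · rcases hcases with h1 | h1 | h1
    · exact Or.inl h1
    -- The leftover case `t' = 1` is excluded geometrically; the argument removes a vector from a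
    -- point of the truncated variety, hence needs `n ≥ 1`.
    · obtain ⟨k, rfl⟩ : ∃ k, n = k + 1 := ⟨n - 1, by omega⟩
      refine absurd ?_ (not_finrank_contractionKernel_add_one (B := B) (φ := φ) hB.monotoneOn)
      rw [hEker, hB0, ← codimIn_add_finrank (inf_le_right : E ⊓ A (k + 1) ≤ A (k + 1)), ← ht', h1,
        add_comm]
    · rw [hEker, hB1, hB0] at h1
      simp only [hcw, hw]
      exact Or.inr h1

end Code

end SchubertCodes

theorem theorem3p5 {K : Type*} [Field K] [Fintype K] [DecidableEq K]
    {V : Type*} [AddCommGroup V] [Module K V] [FiniteDimensional K V]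
    (q ℓ m : ℕ) (hq : Fintype.card K = q) (hℓ : 1 ≤ ℓ) (hℓm : ℓ < m)
    (hm : Module.finrank K V = m)
    (A : ℕ → Submodule K V) (hA : SchubertCodes.IsPartialFlag A ℓ)
    (α : ℕ → ℕ) (hα : ∀ i ∈ Set.Icc 1 ℓ, Module.finrank K (A i) = α i)
    (vol : ⋀[K]^m V ≃ₗ[K] K)
    (P : SchubertCodes.SchubertVariety A ℓ → ⋀[K]^ℓ V) (hP : SchubertCodes.IsPlueckerChoice P) :
    SchubertCodes.minDist (SchubertCodes.schubertCode hℓm.le vol P)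
        = q ^ (∑ i ∈ Finset.Icc 1 ℓ, (α i - i)) ∧
    (1 < ℓ →
      ∀ P' : SchubertCodes.SchubertVariety A (ℓ - 1) → ⋀[K]^(ℓ - 1) V,
      SchubertCodes.IsPlueckerChoice P' →
      ∀ f : ⋀[K]^(m - ℓ) V,
      SchubertCodes.IsMinWeightCodeword (SchubertCodes.schubertCode hℓm.le vol P)
        (SchubertCodes.evalMap hℓm.le vol P f) →
      -- `c x` is the codeword of `f ∧ x` in the Schubert code of the truncated flag
      ∀ c : V →ₗ[K] (SchubertCodes.SchubertVariety A (ℓ - 1) → K),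
      c = SchubertCodes.evalMap ((Nat.sub_le ℓ 1).trans hℓm.le) vol P' ∘ₗ
          SchubertCodes.wedgeVec (by omega : m - ℓ + 1 = m - (ℓ - 1)) f →
      ∀ E : Submodule K V, E = A ℓ ⊓ LinearMap.ker c →
      ∀ F : Set V, F = (A ℓ : Set V) \ (E : Set V) →
      ∀ t t' : ℕ, t = SchubertCodes.codimIn (A ℓ) E →
      t' = SchubertCodes.codimIn (A (ℓ - 1)) (E ⊓ A (ℓ - 1)) →
      (∀ x ∈ F, SchubertCodes.IsMinWeightCodeword
        (SchubertCodes.schubertCode ((Nat.sub_le ℓ 1).trans hℓm.le) vol P') (c x)) ∧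
      ((t = 1 ∧ t' = 0) ∨
        (t' = t ∧ 2 ≤ t ∧ α ℓ = α (ℓ - 1) + 1 ∧
          (hammingNorm (SchubertCodes.evalMap hℓm.le vol P f) : ℚ) =
            1 / ((q : ℚ) ^ (ℓ - 1) * ((q : ℚ) - 1)) *
                ∑ᶠ x ∈ F \ (A (ℓ - 1) : Set V), (hammingNorm (c x) : ℚ) +
              1 / ((q : ℚ) ^ (ℓ - 1) * ((q : ℚ) ^ t - 1)) *
                ∑ᶠ x ∈ F ∩ (A (ℓ - 1) : Set V), (hammingNorm (c x) : ℚ)))) := by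

  subst hq
  rw [← Nat.card_eq_fintype_card]
  constructor
  · rw [SchubertCodes.minDist_schubertCode hA hℓm.le hm vol hP]
    refine congrArg _ (Finset.sum_congr rfl fun i hi => ?_)
    rw [Finset.mem_Icc] at hi
    rw [Function.update_of_ne (by omega), hα i hi]
  · intro hℓ1 P' hP' f hf c hc E hE F hF t t' ht ht'
    obtain ⟨n, rfl⟩ : ∃ n, ℓ = n + 1 := ⟨ℓ - 1, by omega⟩
    subst hF
    have key := SchubertCodes.contraction_of_isMinWeightCodeword (n := n) (by omega) hA hℓm.le
      (by omega) hm vol hP hP' (by omega) hf hc hE ht ht'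
    rw [hα (n + 1) ⟨by omega, le_rfl⟩, hα n ⟨by omega, by omega⟩] at key
    exact key
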